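/- Let $\mathbb K$ be a field of characteristic $0$. A (nonassociative) $\mathbb K$-algebra is metabelian Lie-admissible if its commutator $[a,b]=ab-ba$ satisfies the Jacobi identity and $(ab)(cd)=0$ holds identically. Let $F_n$ be the free such algebra on $x_1,\dots,x_n$, write $a\bullet b=ab-ba$ and $a\circ b=ab+ba$, and let $S_n$ act on $F_n$ by $\sigma p(x_1,\dots,x_n)=p(x_{\sigma(1)},\dots,x_{\sigma(n)})$; $p$ is symmetric if $\sigma p=p$ for all $\sigma\in S_n$. The multilinear part $P_n\subset F_n$ is the span of the monomials containing each $x_i$ exactly once. For a colour pattern $c=(*_1,\dots,*_{n-1})\in\{\bullet,\circ\}^{n-1}$ let $V_c\subseteq P_n$ be the span of all monomials $$x_{i_1}*_1(x_{i_2}*_2(\cdots(x_{i_{n-1}}*_{n-1}x_{i_n})\cdots)),\qquad (i_1,\dots,i_n)\text{ a permutation of }(1,\dots,n).$$ The polynomials $p_c$ are defined as follows. Divide $c$ into maximal runs of equal colours. * If $*_{n-1}=\circ$, then $p_c$ is the sum of the monomials above over all permutations $(i_1,\dots,i_n)$ such that the generators belonging to each run of black vertices are in descending order and $i_{n-1}<i_n$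 (the order is otherwise arbitrary). * If $*_{n-1}=\bullet$ and the last run has length $m$, then $p_c$ is the sum over all choices of $i_1,\dots,i_{n-m-1}$, distinct and descending along each run of black vertices, of $$x_{i_1}*_1(\cdots(x_{i_{n-m-1}}*_{n-m-1}\,q(x_{j_1},\dots,x_{j_{m+1}}))\cdots),$$ where $j_1<\dots<j_{m+1}$ are the remaining indices and $q$ is a symmetric polynomial in the multilinear part of the free metabelian Lie algebra (the free Lie algebra modulo its second derived ideal) on $m+1$ generators, evaluated with respect to $[\cdot,\cdot]$. **Theorem.** Let $n\ge 3$. 1. $P_n=\bigoplus_{c\in\{\bullet,\circ\}^{n-1}}V_c$, and every $V_c$ is stable under $S_n$. 2. For every $c$ the space of symmetric polynomials in $V_c$ is spanned by the polynomials $p_c$. If $*_{n-1}=\circ$, then $p_c\neq0$, so $V_c$ contains a symmetric polynomial that is nonzero and unique up to a scalar, namely $p_c$. If $*_{n-1}=\bullet$, then $q=0$ is a possible choice, every choice of $q$ gives $p_c=0$, and the only symmetric polynomial in $V_c$ is $0$. 3. Consequently the space of symmetric polynomials in $P_n$ is spanned by the polynomials $p_c$, $c\in\{\bullet,\circ\}^{n-1}$.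 In low degree, the symmetric polynomials in $P_1$ and $P_2$ are the scalar multiples of $p_{(1)}=\sum_i x_i$ and of $p_{(2)}=\sum_{i\ne j}x_i\circ x_j$, respectively. More generally, for any number $n\ge 0$ of generators, the symmetric polynomials in the span of $x_1,\dots,x_n$ are the multiples of $\sum_i x_i$, and those in the span of the products $x_ix_j$, $i\neq j$, are the multiples of $\sum_{i\neq j}x_i\circ x_j$. -/

import Mathlib

noncomputable section

/-! ## Metabelian Lie-admissible algebras and the free ones -/

/-- The left-hand side of the Lie-admissibility identity. -/
def lieAdmissibleExpr {A : Type*} [NonUnitalNonAssocRing A] (a b c : A) : A :=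
  (a * b) * c - (b * a) * c - c * (a * b) + c * (b * a)
    + (b * c) * a - (c * b) * a - a * (b * c) + a * (c * b)
    + (c * a) * b - (a * c) * b - b * (c * a) + b * (a * c)

/-- A (nonassociative) algebra is metabelian Lie-admissible if it satisfies the Lie-admissibility
identity and `(ab)(cd) = 0`. -/
structure IsMetabelianLieAdmissible (A : Type*) [NonUnitalNonAssocRing A] : Prop where
  lieAdmissible : ∀ a b c : A, lieAdmissibleExpr a b c = 0
  metabelian : ∀ a b c d : A, (a * b) * (c * d) = 0

/-- The conditions on a subspace of the free nonassociative algebra: it is a two-sided ideal and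
it contains all values of the two identities. -/
structure IsVerbalIdeal {K : Type*} [Field K] {X : Type*}
    (I : Submodule K (FreeNonUnitalNonAssocAlgebra K X)) : Prop where
  mul_left : ∀ a b, b ∈ I → a * b ∈ I
  mul_right : ∀ a b, a ∈ I → a * b ∈ I
  lieAdmissible : ∀ a b c, lieAdmissibleExpr a b c ∈ I
  metabelian : ∀ a b c d, (a * b) * (c * d) ∈ I

/-- The smallest two-sided ideal containing all values of the identities. -/
def verbalIdeal (K : Type*) [Field K] (X : Type*) :
    Submodule K (FreeNonUnitalNonAssocAlgebra K X) :=
  sInf {I | IsVerbalIdeal I}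

theorem isVerbalIdeal_verbalIdeal (K : Type*) [Field K] (X : Type*) :
    IsVerbalIdeal (verbalIdeal K X) where
  mul_left a b hb := by
    rw [verbalIdeal, Submodule.mem_sInf] at hb ⊢
    exact fun I hI => hI.mul_left a b (hb I hI)
  mul_right a b hb := by
    rw [verbalIdeal, Submodule.mem_sInf] at hb ⊢
    exact fun I hI => hI.mul_right a b (hb I hI)
  lieAdmissible a b c := by
    rw [verbalIdeal, Submodule.mem_sInf]
    exact fun I hI => hI.lieAdmissible a b c
  metabelian a b c d := by
    rw [verbalIdeal, Submodule.mem_sInf]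
    exact fun I hI => hI.metabelian a b c d

/-- The free metabelian Lie-admissible `K`-algebra on the set `X`. -/
def FreeMLA (K : Type*) [Field K] (X : Type*) : Type _ :=
  FreeNonUnitalNonAssocAlgebra K X ⧸ verbalIdeal K X

namespace FreeMLA

variable {K : Type*} [Field K] {X : Type*}

instance : AddCommGroup (FreeMLA K X) :=
  inferInstanceAs (AddCommGroup (FreeNonUnitalNonAssocAlgebra K X ⧸ verbalIdeal K X))

instance : Module K (FreeMLA K X) :=
  inferInstanceAs (Module K (FreeNonUnitalNonAssocAlgebra K X ⧸ verbalIdeal K X))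

/-- The quotient map from the free nonassociative algebra. -/
def mk : FreeNonUnitalNonAssocAlgebra K X →ₗ[K] FreeMLA K X :=
  (verbalIdeal K X).mkQ

theorem mk_surjective : Function.Surjective (mk : _ → FreeMLA K X) :=
  Submodule.mkQ_surjective _

theorem mk_eq_zero {a : FreeNonUnitalNonAssocAlgebra K X} :
    (mk a : FreeMLA K X) = 0 ↔ a ∈ verbalIdeal K X :=
  Submodule.Quotient.mk_eq_zero _

/-- The multiplication of the free nonassociative algebra, descended to the quotient. -/
def mulLin : FreeMLA K X →ₗ[K] FreeMLA K X →ₗ[K] FreeMLA K X :=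
  (verbalIdeal K X).liftQ
    (LinearMap.flip ((verbalIdeal K X).liftQ
      (LinearMap.flip ((LinearMap.mul K (FreeNonUnitalNonAssocAlgebra K X)).compr₂ mk))
      (by
        intro b hb
        rw [LinearMap.mem_ker]
        refine LinearMap.ext fun a => ?_
        exact mk_eq_zero.2 ((isVerbalIdeal_verbalIdeal K X).mul_left a b hb))))
    (by
      intro a ha
      rw [LinearMap.mem_ker]
      refine LinearMap.ext fun b => ?_
      obtain ⟨b, rfl⟩ := mk_surjective b
      exact mk_eq_zero.2 ((isVerbalIdeal_verbalIdeal K X).mul_right a b ha))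

instance : Mul (FreeMLA K X) := ⟨fun a b => mulLin a b⟩

theorem mk_mul (a b : FreeNonUnitalNonAssocAlgebra K X) :
    (mk (a * b) : FreeMLA K X) = mk a * mk b := rfl

instance : NonUnitalNonAssocRing (FreeMLA K X) where
  left_distrib a b c := map_add (mulLin a) b c
  right_distrib a b c := LinearMap.map_add₂ mulLin a b c
  zero_mul a := LinearMap.map_zero₂ mulLin a
  mul_zero a := map_zero (mulLin a)

instance : IsScalarTower K (FreeMLA K X) (FreeMLA K X) where
  smul_assoc r a b := LinearMap.map_smul₂ mulLin r a b

instance : SMulCommClass K (FreeMLA K X) (FreeMLA K X) where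
  smul_comm r a b := ((mulLin a).map_smul r b).symm

theorem mk_lieAdmissibleExpr (a b c : FreeNonUnitalNonAssocAlgebra K X) :
    (mk (lieAdmissibleExpr a b c) : FreeMLA K X) = lieAdmissibleExpr (mk a) (mk b) (mk c) := by
  simp only [lieAdmissibleExpr, map_add, map_sub, mk_mul]

theorem isMetabelianLieAdmissible : IsMetabelianLieAdmissible (FreeMLA K X) where
  lieAdmissible a b c := by
    obtain ⟨a, rfl⟩ := mk_surjective a
    obtain ⟨b, rfl⟩ := mk_surjective b
    obtain ⟨c, rfl⟩ := mk_surjective c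
    rw [← mk_lieAdmissibleExpr]
    exact mk_eq_zero.2 ((isVerbalIdeal_verbalIdeal K X).lieAdmissible a b c)
  metabelian a b c d := by
    obtain ⟨a, rfl⟩ := mk_surjective a
    obtain ⟨b, rfl⟩ := mk_surjective b
    obtain ⟨c, rfl⟩ := mk_surjective c
    obtain ⟨d, rfl⟩ := mk_surjective d
    exact mk_eq_zero.2 ((isVerbalIdeal_verbalIdeal K X).metabelian a b c d)

/-- The free generators. -/
def x (i : X) : FreeMLA K X := mk (FreeNonUnitalNonAssocAlgebra.of K i)

/-- Universal property: a map from `X` to a metabelian Lie-admissible algebra extends to an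
algebra homomorphism. -/
def lift {A : Type*} [NonUnitalNonAssocRing A] [Module K A] [IsScalarTower K A A]
    [SMulCommClass K A A] (hA : IsMetabelianLieAdmissible A) (f : X → A) :
    FreeMLA K X →ₙₐ[K] A where
  toFun := (verbalIdeal K X).liftQ
    ((FreeNonUnitalNonAssocAlgebra.lift K f : _ →ₙₐ[K] A) : _ →ₗ[K] A)
    (sInf_le (by
      refine ⟨?_, ?_, ?_, ?_⟩
      · intro a b hb
        simp_all [LinearMap.mem_ker]
      · intro a b hb
        simp_all [LinearMap.mem_ker]
      · intro a b c
        have := hA.lieAdmissible (FreeNonUnitalNonAssocAlgebra.lift K f a)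
          (FreeNonUnitalNonAssocAlgebra.lift K f b) (FreeNonUnitalNonAssocAlgebra.lift K f c)
        simpa [LinearMap.mem_ker, lieAdmissibleExpr] using this
      · intro a b c d
        simp [LinearMap.mem_ker, hA.metabelian]))
  map_smul' r a := map_smul _ r a
  map_zero' := map_zero _
  map_add' a b := map_add _ a b
  map_mul' a b := by
    obtain ⟨a, rfl⟩ := mk_surjective a
    obtain ⟨b, rfl⟩ := mk_surjective b
    exact map_mul (FreeNonUnitalNonAssocAlgebra.lift K f) a b

theorem lift_x {A : Type*} [NonUnitalNonAssocRing A] [Module K A] [IsScalarTower K A A]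
    [SMulCommClass K A A] (hA : IsMetabelianLieAdmissible A) (f : X → A) (i : X) :
    lift (K := K) hA f (x i) = f i :=
  FreeNonUnitalNonAssocAlgebra.lift_of_apply K f i

/-- A permutation `σ` acts by `p(x₁, …, xₙ) ↦ p(x_{σ(1)}, …, x_{σ(n)})`. -/
def permute (σ : Equiv.Perm X) : FreeMLA K X →ₙₐ[K] FreeMLA K X :=
  lift isMetabelianLieAdmissible fun i => x (σ i)

/-- The symmetric polynomials. -/
def symmetric (K : Type*) [Field K] (X : Type*) : Submodule K (FreeMLA K X) where
  carrier := {p | ∀ σ : Equiv.Perm X, permute σ p = p}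
  add_mem' ha hb σ := by rw [map_add, ha σ, hb σ]
  zero_mem' σ := map_zero _
  smul_mem' r a ha σ := by rw [map_smul, ha σ]

/-- The commutator `[a, b] = ab - ba` makes the free metabelian Lie-admissible algebra a
Lie algebra. -/
instance : LieRing (FreeMLA K X) where
  add_lie a b c := by simp only [Ring.lie_def]; noncomm_ring
  lie_add a b c := by simp only [Ring.lie_def]; noncomm_ring
  lie_self a := by simp only [Ring.lie_def, sub_self]
  leibniz_lie a b c := by
    have h := isMetabelianLieAdmissible.lieAdmissible a b c
    simp only [lieAdmissibleExpr] at h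
    simp only [Ring.lie_def, mul_sub, sub_mul]
    rw [← sub_eq_zero, ← neg_eq_zero, ← h]
    abel

instance : LieAlgebra K (FreeMLA K X) where
  lie_smul r a b := by
    simp only [Ring.lie_def, mul_smul_comm, smul_mul_assoc, smul_sub]

theorem lie_metabelian (a b c d : FreeMLA K X) : ⁅⁅a, b⁆, ⁅c, d⁆⁆ = 0 := by
  simp only [Ring.lie_def, mul_sub, sub_mul, isMetabelianLieAdmissible.metabelian, sub_self]

end FreeMLA

/-- The anticommutator `{a, b} = ab + ba`. -/
def antiComm {A : Type*} [NonUnitalNonAssocRing A] (a b : A) : A := a * b + b * a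

/-- The generators occurring in a nonassociative word, with multiplicity. -/
def FreeMagma.letters {X : Type*} : FreeMagma X → Multiset X
  | .of i => {i}
  | .mul u v => u.letters + v.letters

/-- A word is multilinear if it contains each generator exactly once. -/
def FreeMagma.IsMultilinear {X : Type*} [DecidableEq X] (w : FreeMagma X) : Prop :=
  ∀ i, w.letters.count i = 1

/-- The multilinear part of the free metabelian Lie-admissible algebra. -/
def FreeMLA.multilinearPart (K : Type*) [Field K] (X : Type*) [DecidableEq X] :
    Submodule K (FreeMLA K X) :=
  Submodule.span K ((FreeMagma.lift (FreeMLA.x (K := K) (X := X))) '' {w | w.IsMultilinear})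

/-! ## The free metabelian Lie algebra -/

/-- The free metabelian Lie algebra: the free Lie algebra modulo its second derived ideal. -/
abbrev FreeMetLie (K : Type*) [Field K] (T : Type*) : Type _ :=
  FreeLieAlgebra K T ⧸ LieAlgebra.derivedSeries K (FreeLieAlgebra K T) 2

namespace FreeMetLie

variable {K : Type*} [Field K] {T : Type*}

/-- The quotient map from the free Lie algebra. -/
def mk : FreeLieAlgebra K T →ₗ[K] FreeMetLie K T :=
  ((LieAlgebra.derivedSeries K (FreeLieAlgebra K T) 2).toSubmodule).mkQ

/-- The free generators. -/
def y (t : T) : FreeMetLie K T := mk (FreeLieAlgebra.of K t)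

theorem derivedSeries_le_ker {L M : Type*} [LieRing L] [LieAlgebra K L] [LieRing M]
    [LieAlgebra K M] (hM : ∀ a b c d : M, ⁅⁅a, b⁆, ⁅c, d⁆⁆ = 0) (φ : L →ₗ⁅K⁆ M) :
    LieAlgebra.derivedSeries K L 2 ≤ φ.ker := by
  have h1 : ∀ u ∈ LieAlgebra.derivedSeries K L 1,
      φ u ∈ Submodule.span K {m : M | ∃ a b : M, ⁅a, b⁆ = m} := by
    intro u hu
    rw [LieAlgebra.derivedSeries_def, LieAlgebra.derivedSeriesOfIdeal_succ,
      ← LieSubmodule.mem_toSubmodule, LieSubmodule.lieIdeal_oper_eq_linear_span'] at hu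
    induction hu using Submodule.span_induction with
    | mem u hu =>
      obtain ⟨a, -, b, -, rfl⟩ := hu
      exact Submodule.subset_span ⟨φ a, φ b, (LieHom.map_lie φ a b).symm⟩
    | zero => simp
    | add u v _ _ hu hv => rw [map_add]; exact add_mem hu hv
    | smul r u _ hu => rw [map_smul]; exact Submodule.smul_mem _ _ hu
  have h2 : ∀ u ∈ Submodule.span K {m : M | ∃ a b : M, ⁅a, b⁆ = m},
      ∀ v ∈ Submodule.span K {m : M | ∃ a b : M, ⁅a, b⁆ = m}, ⁅u, v⁆ = 0 := by
    intro u hu v hv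
    induction hu, hv using Submodule.span_induction₂ with
    | mem_mem u v hu hv =>
      obtain ⟨a, b, rfl⟩ := hu
      obtain ⟨c, d, rfl⟩ := hv
      exact hM a b c d
    | zero_left => simp
    | zero_right => simp
    | add_left _ _ _ _ _ _ h h' => rw [add_lie, h, h', add_zero]
    | add_right _ _ _ _ _ _ h h' => rw [lie_add, h, h', add_zero]
    | smul_left _ _ _ _ _ h => rw [smul_lie, h, smul_zero]
    | smul_right _ _ _ _ _ h => rw [lie_smul, h, smul_zero]
  intro z hz
  rw [LieAlgebra.derivedSeries_def, LieAlgebra.derivedSeriesOfIdeal_succ,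
    ← LieSubmodule.mem_toSubmodule, LieSubmodule.lieIdeal_oper_eq_linear_span'] at hz
  rw [LieHom.mem_ker]
  induction hz using Submodule.span_induction with
  | mem u hu =>
    obtain ⟨a, ha, b, hb, rfl⟩ := hu
    rw [LieHom.map_lie]
    exact h2 _ (h1 a ha) _ (h1 b hb)
  | zero => simp
  | add u v _ _ hu hv => rw [map_add, hu, hv, add_zero]
  | smul r u _ hu => rw [map_smul, hu, smul_zero]

/-- Substitution of elements `f t` of a metabelian Lie algebra for the generators. -/
def eval {M : Type*} [LieRing M] [LieAlgebra K M]
    (hM : ∀ a b c d : M, ⁅⁅a, b⁆, ⁅c, d⁆⁆ = 0) (f : T → M) : FreeMetLie K T →ₗ[K] M :=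
  ((LieAlgebra.derivedSeries K (FreeLieAlgebra K T) 2).toSubmodule).liftQ
    ((FreeLieAlgebra.lift K f : FreeLieAlgebra K T →ₗ⁅K⁆ M) : FreeLieAlgebra K T →ₗ[K] M)
    (fun z hz => by
      have := derivedSeries_le_ker hM (FreeLieAlgebra.lift K f) hz
      rw [LieHom.mem_ker] at this
      simpa [LinearMap.mem_ker] using this)

theorem eval_y {M : Type*} [LieRing M] [LieAlgebra K M]
    (hM : ∀ a b c d : M, ⁅⁅a, b⁆, ⁅c, d⁆⁆ = 0) (f : T → M) (t : T) :
    eval (K := K) hM f (y t) = f t :=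
  FreeLieAlgebra.lift_of_apply f t

theorem lie_metabelian (a b c d : FreeMetLie K T) : ⁅⁅a, b⁆, ⁅c, d⁆⁆ = 0 := by
  obtain ⟨a, rfl⟩ := LieSubmodule.Quotient.surjective_mk' _ a
  obtain ⟨b, rfl⟩ := LieSubmodule.Quotient.surjective_mk' _ b
  obtain ⟨c, rfl⟩ := LieSubmodule.Quotient.surjective_mk' _ c
  obtain ⟨d, rfl⟩ := LieSubmodule.Quotient.surjective_mk' _ d
  have h1 : ∀ a b : FreeLieAlgebra K T,
      ⁅a, b⁆ ∈ LieAlgebra.derivedSeries K (FreeLieAlgebra K T) 1 := fun a b => by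
    rw [LieAlgebra.derivedSeries_def, LieAlgebra.derivedSeriesOfIdeal_succ]
    exact LieSubmodule.lie_mem_lie (LieSubmodule.mem_top a) (LieSubmodule.mem_top b)
  have h2 : ⁅⁅a, b⁆, ⁅c, d⁆⁆ ∈ LieAlgebra.derivedSeries K (FreeLieAlgebra K T) 2 := by
    rw [LieAlgebra.derivedSeries_def, LieAlgebra.derivedSeriesOfIdeal_succ]
    exact LieSubmodule.lie_mem_lie (h1 a b) (h1 c d)
  exact (LieSubmodule.Quotient.mk_eq_zero (N := LieAlgebra.derivedSeries K _ 2)).2 h2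

/-- The value of a nonassociative word in the free metabelian Lie algebra. -/
def word : FreeMagma T → FreeMetLie K T
  | .of t => y t
  | .mul u v => ⁅word u, word v⁆

/-- The symmetric polynomials in the multilinear part of the free metabelian Lie algebra. -/
def multilinearSymmetric (K : Type*) [Field K] (T : Type*) [DecidableEq T] :
    Submodule K (FreeMetLie K T) where
  carrier := {q | q ∈ Submodule.span K (word '' {w : FreeMagma T | w.IsMultilinear}) ∧
    ∀ τ : Equiv.Perm T, eval lie_metabelian (fun t => y (τ t)) q = q}
  add_mem' ha hb := ⟨add_mem ha.1 hb.1, fun τ => by rw [map_add, ha.2 τ, hb.2 τ]⟩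
  zero_mem' := ⟨zero_mem _, fun τ => map_zero _⟩
  smul_mem' r a ha := ⟨Submodule.smul_mem _ r ha.1, fun τ => by rw [map_smul, ha.2 τ]⟩

end FreeMetLie

/-! ## Colour patterns and the polynomials attached to them -/

/-- The colour of a vertex: black stands for the bracket, white for the anticommutator. -/
inductive Color
  | black
  | white
  deriving DecidableEq

/-- The operation attached to a colour. -/
def Color.op {A : Type*} [NonUnitalNonAssocRing A] : Color → A → A → A
  | .black, a, b => ⁅a, b⁆
  | .white, a, b => antiComm a b

/-- `rightNormed c a` is `a₀ *₀ (a₁ *₁ (⋯ (aₖ₋₁ *ₖ₋₁ aₖ)⋯))`, the operation `*ⱼ` being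
given by the colour `c j`. -/
def rightNormed {A : Type*} [NonUnitalNonAssocRing A] :
    {k : ℕ} → (Fin k → Color) → (Fin (k + 1) → A) → A
  | 0, _, a => a 0
  | _ + 1, c, a => (c 0).op (a 0) (rightNormed (Fin.tail c) (Fin.tail a))

open Classical in
/-- The same nested product, but with the factor formed by the terminal run of black vertices
(and the last leaf) replaced by the element `z`. -/
def rightNormedTail {A : Type*} [NonUnitalNonAssocRing A] :
    {k : ℕ} → (Fin k → Color) → (Fin (k + 1) → A) → A → A
  | 0, _, _, z => z
  | _ + 1, c, a, z =>
    if ∀ j, c j = .black then z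
    else (c 0).op (a 0) (rightNormedTail (Fin.tail c) (Fin.tail a) z)

/-- The last vertex of the pattern `c` has colour `e`. -/
def EndsIn {k : ℕ} (c : Fin k → Color) (e : Color) : Prop :=
  ∃ i : Fin k, (i : ℕ) + 1 = k ∧ c i = e

/-- The leaf position `j` belongs to the terminal run of black vertices or is the last leaf:
all vertices from `j` on are black. -/
def InTail {k : ℕ} (c : Fin k → Color) (j : Fin (k + 1)) : Prop :=
  ∀ i : Fin k, j ≤ i.castSucc → c i = .black

/-- The arrangements `j ↦ x_{σ j}` of the generators that are used for the pattern `c`. -/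
structure Admissible {k : ℕ} (c : Fin k → Color) (σ : Equiv.Perm (Fin (k + 1))) : Prop where
  /-- in each run of black vertices which is not terminal the generators are descending -/
  black_run : ∀ i j : Fin k, (i : ℕ) + 1 = j → c i = .black → c j = .black →
    ¬ InTail c i.castSucc → σ j.castSucc < σ i.castSucc
  /-- if the last vertex is white, its two generators are ordered -/
  white_end : ∀ i : Fin k, (i : ℕ) + 1 = k → c i = .white → σ i.castSucc < σ i.succ
  /-- for a terminal black run only a set of generators is selected (and listed increasingly) -/
  tail_select : ∀ i j : Fin (k + 1), InTail c i → InTail c j → i < j → σ i < σ j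

namespace FreeMLA

variable {K : Type*} [Field K] {k : ℕ}

/-- The space of the colour pattern `c`: the span of all multilinear right-normed monomials
with this pattern. -/
def patternSpace (K : Type*) [Field K] {k : ℕ} (c : Fin k → Color) :
    Submodule K (FreeMLA K (Fin (k + 1))) :=
  Submodule.span K (Set.range fun σ : Equiv.Perm (Fin (k + 1)) =>
    rightNormed c fun j => x (σ j))

open Classical in
/-- The polynomial of a pattern whose last vertex is white. -/
def whiteEndPoly (K : Type*) [Field K] {k : ℕ} (c : Fin k → Color) :
    FreeMLA K (Fin (k + 1)) :=
  ∑ σ : Equiv.Perm (Fin (k + 1)) with Admissible c σ, rightNormed c fun j => x (σ j)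

open Classical in
/-- The polynomial of a pattern whose last vertex is black, built from a metabelian Lie
polynomial `q` in generators labelled by the leaf positions of the terminal black run. -/
def blackEndPoly (c : Fin k → Color) (q : FreeMetLie K {j : Fin (k + 1) // InTail c j}) :
    FreeMLA K (Fin (k + 1)) :=
  ∑ σ : Equiv.Perm (Fin (k + 1)) with Admissible c σ,
    rightNormedTail c (fun j => x (σ j))
      (FreeMetLie.eval lie_metabelian
        (fun j : {j : Fin (k + 1) // InTail c j} => (x (σ j) : FreeMLA K (Fin (k + 1)))) q)

/-- The polynomials `p_c` of the pattern `c`. There is exactly one if the last vertex is white;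
if it is black, there is one for each symmetric multilinear polynomial of the free metabelian
Lie algebra on the terminal run. -/
def patternPolys (K : Type*) [Field K] {k : ℕ} (c : Fin k → Color) :
    Set (FreeMLA K (Fin (k + 1))) :=
  {p | (EndsIn c .white ∧ p = whiteEndPoly K c) ∨
    (EndsIn c .black ∧
      ∃ q ∈ FreeMetLie.multilinearSymmetric K {j : Fin (k + 1) // InTail c j},
        p = blackEndPoly c q)}

/-- The sum of all generators. -/
def pOne (K : Type*) [Field K] (n : ℕ) : FreeMLA K (Fin n) := ∑ i, x i

/-- The sum of all anticommutators of two different generators. -/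
def pTwo (K : Type*) [Field K] (n : ℕ) : FreeMLA K (Fin n) :=
  ∑ ij : Fin n × Fin n with ij.1 ≠ ij.2, antiComm (x ij.1) (x ij.2)

end FreeMLA

end

noncomputable section

/-! ### Calculus of coloured nested products -/

section Operations

variable {K A B : Type*} [Field K] [NonUnitalNonAssocRing A] [NonUnitalNonAssocRing B]

/-! Since the product of two products vanishes, a nonzero word of length at least two has a
generator as one of its factors. In characteristic not two, `ab` and `ba` are combinations of the
bracket and the anticommutator, so by induction words reduce to right-normed monomials
(`lift_x_mem_span_rightNormedMonomials`), and the pattern spaces span the multilinear part.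

The sum is direct because a monomial remembers its pattern. Families of elements of the free algebra
indexed by colour lists carry a metabelian Lie-admissible product that prepends the colour of the
top vertex to the index. The homomorphism `toPatternFamilies` sends a monomial of pattern `c` to a
nonzero multiple of itself placed at `c`, and reading off one entry separates the patterns
(`iSupIndep_patternSpace`).

The symmetric group permutes the monomials of a pattern transitively. Averaging therefore leaves
only the multiples of the orbit sum (`symmetric_inf_span_orbit`), and the last vertex decides what
this sum is.

If the last vertex is black, exchanging its two leaves changes the sign, so the orbit sum vanishes.
The same exchange inside a Lie word leaves zero as the only symmetric multilinear Lie polynomial in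
at least two generators, so every choice of `q` gives zero.

If it is white, a monomial does not change when its leaves are permuted inside a black run or at the
last vertex. Admissible arrangements represent the cosets of the group of these permutations, so the
orbit sum is the order of this group times `whiteEndPoly`. No cancellation occurs: in `LeftModel`
all these monomials take the same nonzero value. -/

@[simp]
theorem Color.op_zero (e : Color) (a : A) : e.op a 0 = 0 := by
  cases e <;> simp [Color.op, antiComm, Ring.lie_def]

theorem Color.op_add (e : Color) (a b c : A) : e.op a (b + c) = e.op a b + e.op a c := by
  cases e <;> simp only [Color.op, antiComm, Ring.lie_def, mul_add, add_mul] <;> abel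

@[simp]
theorem Color.zero_op (e : Color) (a : A) : e.op 0 a = 0 := by
  cases e <;> simp [Color.op, antiComm, Ring.lie_def]

theorem Color.add_op (e : Color) (a b c : A) : e.op (a + b) c = e.op a c + e.op b c := by
  cases e <;> simp only [Color.op, antiComm, Ring.lie_def, mul_add, add_mul] <;> abel

theorem Color.op_neg (e : Color) (a b : A) : e.op a (-b) = -e.op a b := by
  rw [eq_neg_iff_add_eq_zero, ← Color.op_add, neg_add_cancel, Color.op_zero]

theorem Color.op_smul [Module K A] [IsScalarTower K A A] [SMulCommClass K A A]
    (e : Color) (r : K) (a b : A) : e.op a (r • b) = r • e.op a b := by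
  cases e <;>
    simp only [Color.op, antiComm, Ring.lie_def, mul_smul_comm, smul_mul_assoc, smul_add, smul_sub]

theorem Color.smul_op [Module K A] [IsScalarTower K A A] [SMulCommClass K A A]
    (e : Color) (r : K) (a b : A) : e.op (r • a) b = r • e.op a b := by
  cases e <;>
    simp only [Color.op, antiComm, Ring.lie_def, mul_smul_comm, smul_mul_assoc, smul_add, smul_sub]

theorem Color.map_op {F : Type*} [FunLike F A B] [NonUnitalRingHomClass F A B] (φ : F)
    (e : Color) (a b : A) : φ (e.op a b) = e.op (φ a) (φ b) := by
  cases e <;> simp [Color.op, antiComm, Ring.lie_def]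

/-- The sign by which the operation of a colour changes when its arguments are exchanged. -/
def Color.sign : Color → ℤ
  | .black => -1
  | .white => 1

theorem Color.op_comm (e : Color) (a b : A) : e.op b a = e.sign • e.op a b := by
  cases e <;> simp [Color.op, Color.sign, antiComm, Ring.lie_def, add_comm]

theorem map_rightNormed {F : Type*} [FunLike F A B] [NonUnitalRingHomClass F A B] (φ : F) :
    ∀ {k : ℕ} (c : Fin k → Color) (a : Fin (k + 1) → A),
      φ (rightNormed c a) = rightNormed c (φ ∘ a)
  | 0, _, _ => rfl
  | _ + 1, c, a => by
    rw [rightNormed, rightNormed, Color.map_op, map_rightNormed]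
    rfl

theorem rightNormed_succ {k : ℕ} (c : Fin (k + 1) → Color) (a : Fin (k + 2) → A) :
    rightNormed c a = (c 0).op (a 0) (rightNormed (Fin.tail c) (Fin.tail a)) := rfl

theorem Fin.comp_swap_succ_zero {α : Type*} {k : ℕ} (a : Fin (k + 2) → α) (i : Fin k) :
    (a ∘ Equiv.swap i.succ.castSucc i.succ.succ) 0 = a 0 := by
  rw [Function.comp_apply, ← Fin.succ_castSucc, Equiv.swap_apply_of_ne_of_ne]
  exacts [(Fin.succ_ne_zero _).symm, (Fin.succ_ne_zero _).symm]

/-- Together with the preceding lemma this lets a transposition that avoids the first leaf pass to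
the tail in inductions on the pattern. -/
theorem Fin.tail_comp_swap_succ {α : Type*} {k : ℕ} (a : Fin (k + 2) → α) (i : Fin k) :
    Fin.tail (a ∘ Equiv.swap i.succ.castSucc i.succ.succ) =
      Fin.tail a ∘ Equiv.swap i.castSucc i.succ := by
  funext j
  simp only [Fin.tail, Function.comp_apply, ← Fin.succ_castSucc]
  rw [(Fin.succ_injective _).swap_apply]

/-- Exchanging the last two leaves multiplies a nested product by the sign of its last vertex. -/
theorem rightNormed_swap_last : ∀ {k : ℕ} (c : Fin k → Color) (a : Fin (k + 1) → A) (i : Fin k),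
    (i : ℕ) + 1 = k →
      rightNormed c (a ∘ Equiv.swap i.castSucc i.succ) = (c i).sign • rightNormed c a
  | 1, c, a, i, _ => by
    obtain rfl : i = 0 := Subsingleton.elim _ _
    simp only [rightNormed, Fin.tail, Function.comp_apply]
    simp only [Fin.castSucc_zero, Equiv.swap_apply_left, Equiv.swap_apply_right, Fin.succ_zero_eq_one]
    exact Color.op_comm _ _ _
  | k + 2, c, a, i, hi => by
    obtain ⟨i, rfl⟩ : ∃ j : Fin (k + 1), i = j.succ :=
      ⟨Fin.last k, Fin.ext (by simp at hi ⊢; omega)⟩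
    rw [rightNormed_succ, Fin.comp_swap_succ_zero, Fin.tail_comp_swap_succ,
      rightNormed_swap_last _ _ i (by simpa using hi), rightNormed_succ c a]
    rw [Fin.tail]
    cases c i.succ <;> simp [Color.sign, Color.op_neg]

/-- A nested product with at least one vertex is a sum of products. -/
theorem rightNormed_mem_of_mul_mem [Module K A] (P : Submodule K A) (hP : ∀ a b : A, a * b ∈ P)
    {k : ℕ} (hk : k ≠ 0) (c : Fin k → Color) (a : Fin (k + 1) → A) : rightNormed c a ∈ P := by
  obtain ⟨k, rfl⟩ := Nat.exists_eq_succ_of_ne_zero hk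
  rw [rightNormed]
  cases c 0
  · exact sub_mem (hP _ _) (hP _ _)
  · exact add_mem (hP _ _) (hP _ _)

end Operations

/-! ### The permutation action and the metabelian law -/

namespace FreeMLA

variable {K : Type*} [Field K] {X : Type*}

theorem permute_x (σ : Equiv.Perm X) (i : X) : permute σ (x (K := K) i) = x (σ i) :=
  lift_x _ _ i

theorem permute_rightNormed (σ : Equiv.Perm X) {k : ℕ} (c : Fin k → Color) (a : Fin (k + 1) → X) :
    permute σ (rightNormed c fun j => x (K := K) (a j)) = rightNormed c fun j => x (σ (a j)) := by
  rw [map_rightNormed]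
  congr 1
  funext j
  exact permute_x σ _

/-- The subspace spanned by all products. -/
def products (K : Type*) [Field K] (X : Type*) : Submodule K (FreeMLA K X) :=
  Submodule.span K {p | ∃ a b, p = a * b}

theorem mul_mem_products (a b : FreeMLA K X) : a * b ∈ products K X :=
  Submodule.subset_span ⟨a, b, rfl⟩

theorem op_mem_products (e : Color) (a b : FreeMLA K X) : e.op a b ∈ products K X := by
  cases e
  · exact sub_mem (mul_mem_products _ _) (mul_mem_products _ _)
  · exact add_mem (mul_mem_products _ _) (mul_mem_products _ _)

theorem mul_eq_zero_of_mem_products {a b : FreeMLA K X} (ha : a ∈ products K X)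
    (hb : b ∈ products K X) : a * b = 0 := by
  induction ha, hb using Submodule.span_induction₂ with
  | mem_mem u v hu hv =>
    obtain ⟨a, b, rfl⟩ := hu
    obtain ⟨c, d, rfl⟩ := hv
    exact isMetabelianLieAdmissible.metabelian a b c d
  | zero_left => simp
  | zero_right => simp
  | add_left _ _ _ _ _ _ h h' => rw [add_mul, h, h', add_zero]
  | add_right _ _ _ _ _ _ h h' => rw [mul_add, h, h', add_zero]
  | smul_left _ _ _ _ _ h => rw [smul_mul_assoc, h, smul_zero]
  | smul_right _ _ _ _ _ h => rw [mul_smul_comm, h, smul_zero]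

/-- Bracketings with arbitrary elements commute on the span of the products. -/
theorem lie_lie_comm_of_mem_products (a b : FreeMLA K X) {p : FreeMLA K X}
    (hp : p ∈ products K X) : ⁅a, ⁅b, p⁆⁆ = ⁅b, ⁅a, p⁆⁆ := by
  have h : ⁅⁅a, b⁆, p⁆ = 0 := by
    have hab : ⁅a, b⁆ ∈ products K X := op_mem_products .black a b
    rw [Ring.lie_def ⁅a, b⁆ p, mul_eq_zero_of_mem_products hab hp,
      mul_eq_zero_of_mem_products hp hab, sub_zero]
  rw [leibniz_lie, h, zero_add]

/-- In a run of black vertices adjacent leaves may be exchanged. -/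
theorem rightNormed_swap_black : ∀ {k : ℕ} (c : Fin k → Color) (a : Fin (k + 1) → FreeMLA K X)
    (i : Fin k) (hi : (i : ℕ) + 2 < k), c i = .black → c ⟨i + 1, by omega⟩ = .black →
      rightNormed c (a ∘ Equiv.swap i.castSucc i.succ) = rightNormed c a
  | 1, _, _, _, hi, _, _ => by omega
  | k + 2, c, a, i, hi, h, h' => by
    induction i using Fin.cases with
    | zero =>
      -- The factor below the two black vertices still has a vertex, hence is a sum of products;
      -- brackets commute only on such elements.
      have hk : k ≠ 0 := by rintro rfl; simp at hi
      obtain ⟨k, rfl⟩ := Nat.exists_eq_succ_of_ne_zero hk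
      have h'' : Fin.tail c 0 = .black := h'
      have ht : Fin.tail (Fin.tail (a ∘ Equiv.swap (Fin.castSucc 0) (Fin.succ 0)))
          = Fin.tail (Fin.tail a) := by
        funext j
        simp only [Fin.tail, Function.comp_apply]
        rw [Equiv.swap_apply_of_ne_of_ne]
        · exact Fin.succ_ne_zero _
        · exact fun h => Fin.succ_ne_zero _ (Fin.succ_injective _ h)
      rw [rightNormed_succ, rightNormed_succ, ht, rightNormed_succ c, rightNormed_succ (Fin.tail c),
        h, h'']
      have e0 : (a ∘ Equiv.swap (Fin.castSucc 0) (Fin.succ 0)) 0 = a 1 :=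
        congrArg a (Equiv.swap_apply_left _ _)
      have e1 : Fin.tail (a ∘ Equiv.swap (Fin.castSucc 0) (Fin.succ 0)) 0 = a 0 :=
        congrArg a (Equiv.swap_apply_right _ _)
      rw [e0, e1]
      exact lie_lie_comm_of_mem_products _ _
        (rightNormed_mem_of_mul_mem _ mul_mem_products k.succ_ne_zero _ _)
    | succ i =>
      rw [rightNormed_succ, Fin.comp_swap_succ_zero, Fin.tail_comp_swap_succ,
      rightNormed_swap_black _ _ i (by simp at hi; omega) h h', rightNormed_succ c a]

/-! ### Averaging over the symmetric group -/

theorem sum_mem_symmetric {I : Type*} [Fintype I] (m : I → FreeMLA K X)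
    (hm : ∀ σ : Equiv.Perm X, ∃ e : Equiv.Perm I, ∀ i, permute σ (m i) = m (e i)) :
    ∑ i, m i ∈ symmetric K X := by
  intro σ
  obtain ⟨e, he⟩ := hm σ
  rw [map_sum, Finset.sum_congr rfl fun i _ => he i]
  exact Equiv.sum_comp e m

section Averaging

variable [Fintype X] [DecidableEq X]

/-- A symmetric element times the group order is its own group sum, and group sums are linear; so it
suffices to test the spanning set, and characteristic zero allows division by the order. -/
theorem symmetric_inf_span_le [CharZero K] {Y : Set (FreeMLA K X)} {Z : Submodule K (FreeMLA K X)}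
    (h : ∀ y ∈ Y, ∑ σ : Equiv.Perm X, permute σ y ∈ Z) :
    symmetric K X ⊓ Submodule.span K Y ≤ Z := by
  rintro p ⟨hp, hpY⟩
  have key : ∀ p ∈ Submodule.span K Y, ∑ σ : Equiv.Perm X, permute σ p ∈ Z := by
    intro p hp
    induction hp using Submodule.span_induction with
    | mem y hy => exact h y hy
    | zero => simp
    | add u v _ _ hu hv =>
      simp only [map_add, Finset.sum_add_distrib]
      exact add_mem hu hv
    | smul r u _ hu =>
      simp only [map_smul, ← Finset.smul_sum]
      exact Z.smul_mem r hu
  have h1 := key p hpY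
  rw [Finset.sum_congr rfl fun σ _ => hp σ, Finset.sum_const, Finset.card_univ,
    ← Nat.cast_smul_eq_nsmul K] at h1
  exact (Z.smul_mem_iff (Nat.cast_ne_zero.2 Fintype.card_ne_zero)).1 h1

/-- The symmetric elements in the span of an orbit of the symmetric group are the multiples of
the orbit sum. -/
theorem symmetric_inf_span_orbit [CharZero K] {I : Type*} [Fintype I] (m : I → FreeMLA K X)
    (f : Equiv.Perm X → Equiv.Perm I) (hf : ∀ σ τ, f (σ * τ) = f σ * f τ)
    (hm : ∀ σ i, permute σ (m i) = m (f σ i)) (ht : ∀ i j, ∃ σ, f σ i = j) :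
    symmetric K X ⊓ Submodule.span K (Set.range m) = Submodule.span K {∑ i, m i} := by
  apply le_antisymm
  · apply symmetric_inf_span_le
    rintro _ ⟨i, rfl⟩
    have h1 : ∀ j, ∑ σ, permute σ (m j) = ∑ σ, permute σ (m i) := by
      intro j
      obtain ⟨τ, rfl⟩ := ht i j
      rw [← Equiv.sum_comp (Equiv.mulRight τ) fun σ => permute σ (m i)]
      refine Finset.sum_congr rfl fun σ _ => ?_
      rw [hm, hm, Equiv.coe_mulRight, hf, Equiv.Perm.mul_apply]
    -- Double counting: all `m j` have the same group sum by transitivity, while every group element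
    -- permutes the `m j` among themselves.
    have h2 : (Fintype.card I : K) • ∑ σ, permute σ (m i)
        = (Fintype.card (Equiv.Perm X) : K) • ∑ j, m j := by
      rw [Nat.cast_smul_eq_nsmul, Nat.cast_smul_eq_nsmul]
      calc Fintype.card I • ∑ σ, permute σ (m i) = ∑ j, ∑ σ, permute σ (m j) := by
            rw [Finset.sum_congr rfl fun j _ => h1 j, Finset.sum_const, Finset.card_univ]
        _ = ∑ σ : Equiv.Perm X, ∑ j, m j := by
            rw [Finset.sum_comm]
            refine Finset.sum_congr rfl fun σ _ => ?_
            rw [Finset.sum_congr rfl fun j _ => hm σ j]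
            exact Equiv.sum_comp (f σ) m
        _ = _ := by rw [Finset.sum_const, Finset.card_univ]
    have hI : (Fintype.card I : K) ≠ 0 :=
      Nat.cast_ne_zero.2 (Fintype.card_pos_iff.2 ⟨i⟩).ne'
    refine (Submodule.smul_mem_iff _ hI).1 ?_
    rw [h2]
    exact Submodule.smul_mem _ _ (Submodule.mem_span_singleton_self _)
  · rw [Submodule.span_singleton_le_iff_mem]
    exact ⟨sum_mem_symmetric m fun σ => ⟨f σ, hm σ⟩,
      sum_mem fun i _ => Submodule.subset_span ⟨i, rfl⟩⟩

/-- On the arrangements that index the monomials the group acts by left multiplication, so there is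
a single orbit. -/
theorem symmetric_inf_patternSpace [CharZero K] {k : ℕ} (c : Fin k → Color) :
    symmetric K (Fin (k + 1)) ⊓ patternSpace K c =
      Submodule.span K {∑ σ : Equiv.Perm (Fin (k + 1)), rightNormed c fun j => x (σ j)} :=
  symmetric_inf_span_orbit (fun σ : Equiv.Perm (Fin (k + 1)) => rightNormed c fun j => x (σ j))
    Equiv.mulLeft (fun σ τ => by ext; simp)
    (fun σ τ => permute_rightNormed σ c τ) fun σ τ => ⟨τ * σ⁻¹, by simp⟩

theorem sum_permute_rightNormed {k : ℕ} (c : Fin k → Color) (τ : Equiv.Perm (Fin (k + 1))) :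
    ∑ σ : Equiv.Perm (Fin (k + 1)), permute σ (rightNormed c fun j => x (K := K) (τ j)) =
      ∑ σ : Equiv.Perm (Fin (k + 1)), rightNormed c fun j => x (σ j) := by
  rw [← Equiv.sum_comp (Equiv.mulRight τ) fun σ => rightNormed c fun j => x (K := K) (σ j)]
  exact Finset.sum_congr rfl fun σ _ => permute_rightNormed σ c τ

end Averaging

theorem permute_mem_patternSpace {k : ℕ} (c : Fin k → Color) (σ : Equiv.Perm (Fin (k + 1)))
    (f : FreeMLA K (Fin (k + 1))) (hf : f ∈ patternSpace K c) :
    permute σ f ∈ patternSpace K c := by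
  induction hf using Submodule.span_induction with
  | mem y hy =>
    obtain ⟨τ, rfl⟩ := hy
    exact Submodule.subset_span ⟨σ * τ, (permute_rightNormed σ c τ).symm⟩
  | zero => simp
  | add u v _ _ hu hv => rw [map_add]; exact add_mem hu hv
  | smul r u _ hu => rw [map_smul]; exact Submodule.smul_mem _ r hu

end FreeMLA

/-- Lie-admissibility is the Jacobi identity for the commutator. -/
theorem lieAdmissibleExpr_eq {A : Type*} [NonUnitalNonAssocRing A] (a b c : A) :
    lieAdmissibleExpr a b c = ⁅⁅a, b⁆, c⁆ + ⁅⁅b, c⁆, a⁆ + ⁅⁅c, a⁆, b⁆ := by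
  simp only [lieAdmissibleExpr, Ring.lie_def, mul_sub, sub_mul]
  abel

namespace FreeMLA

variable {K : Type*} [Field K] {X : Type*}

/-! ### Multilinear words and right-normed monomials -/

/-- The right-normed monomials with prescribed letters. -/
def rightNormedMonomials (K : Type*) [Field K] {X : Type*} (s : Multiset X) :
    Set (FreeMLA K X) :=
  {p | ∃ (k : ℕ) (c : Fin k → Color) (a : Fin (k + 1) → X),
    Finset.univ.val.map a = s ∧ p = rightNormed c fun j => x (a j)}

/-- The span of all words with prescribed letters. -/
def wordSpan (K : Type*) [Field K] {X : Type*} (s : Multiset X) : Submodule K (FreeMLA K X) :=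
  Submodule.span K (FreeMagma.lift (x (K := K)) '' {w : FreeMagma X | w.letters = s})

theorem mul_mem_wordSpan {s t : Multiset X} {p q : FreeMLA K X} (hp : p ∈ wordSpan K s)
    (hq : q ∈ wordSpan K t) : p * q ∈ wordSpan K (s + t) := by
  induction hp, hq using Submodule.span_induction₂ with
  | mem_mem u v hu hv =>
    obtain ⟨u, rfl, rfl⟩ := hu
    obtain ⟨v, rfl, rfl⟩ := hv
    exact Submodule.subset_span ⟨u * v, rfl, map_mul _ u v⟩
  | zero_left => simp
  | zero_right => simp
  | add_left _ _ _ _ _ _ h h' => rw [add_mul]; exact add_mem h h'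
  | add_right _ _ _ _ _ _ h h' => rw [mul_add]; exact add_mem h h'
  | smul_left _ _ _ _ _ h => rw [smul_mul_assoc]; exact Submodule.smul_mem _ _ h
  | smul_right _ _ _ _ _ h => rw [mul_smul_comm]; exact Submodule.smul_mem _ _ h

theorem op_mem_wordSpan {s t : Multiset X} {p q : FreeMLA K X} (e : Color)
    (hp : p ∈ wordSpan K s) (hq : q ∈ wordSpan K t) : e.op p q ∈ wordSpan K (s + t) := by
  have h1 := mul_mem_wordSpan hp hq
  have h2 := mul_mem_wordSpan hq hp
  rw [add_comm] at h2
  cases e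
  · exact sub_mem h1 h2
  · exact add_mem h1 h2

theorem x_mem_wordSpan (i : X) : x (K := K) i ∈ wordSpan K {i} :=
  Submodule.subset_span ⟨.of i, rfl, rfl⟩

theorem _root_.Fin.map_univ_val_succ {α : Type*} {k : ℕ} (a : Fin (k + 1) → α) :
    Finset.univ.val.map a = {a 0} + Finset.univ.val.map (Fin.tail a) := by
  simp only [Fin.univ_succ, Finset.cons_val, Multiset.map_cons, Finset.map_val, Multiset.map_map,
    Multiset.singleton_add]
  rfl

theorem rightNormed_mem_wordSpan : ∀ {k : ℕ} (c : Fin k → Color) (a : Fin (k + 1) → X),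
    rightNormed c (fun j => x (K := K) (a j)) ∈ wordSpan K (Finset.univ.val.map a)
  | 0, _, a => by simpa [rightNormed] using x_mem_wordSpan (K := K) (a 0)
  | k + 1, c, a => by
    rw [Fin.map_univ_val_succ]
    exact op_mem_wordSpan _ (x_mem_wordSpan _) (rightNormed_mem_wordSpan _ _)

theorem op_mem_span_rightNormedMonomials (e : Color) (i : X) {s : Multiset X} {p : FreeMLA K X}
    (hp : p ∈ Submodule.span K (rightNormedMonomials K s)) :
    e.op (x i) p ∈ Submodule.span K (rightNormedMonomials K ({i} + s)) := by
  induction hp using Submodule.span_induction with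
  | mem y hy =>
    obtain ⟨k, c, a, rfl, rfl⟩ := hy
    refine Submodule.subset_span ⟨k + 1, Fin.cons e c, Fin.cons i a, ?_, ?_⟩
    · rw [Fin.map_univ_val_succ, Fin.cons_zero, Fin.tail_cons]
    · rw [rightNormed_succ]
      rfl
  | zero => simp
  | add u v _ _ hu hv => rw [Color.op_add]; exact add_mem hu hv
  | smul r u _ hu => rw [Color.op_smul]; exact Submodule.smul_mem _ r hu

theorem mul_mem_products_of_mul (u v : FreeMagma X) :
    FreeMagma.lift (x (K := K)) (u.mul v) ∈ products K X := by
  rw [FreeMagma.mul_eq, map_mul]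
  exact mul_mem_products _ _

/-- With a generator as one factor, twice the product is the anticommutator plus or minus the
bracket; with two composite factors the metabelian law gives zero. -/
theorem lift_x_mem_span_rightNormedMonomials [CharZero K] (w : FreeMagma X) :
    FreeMagma.lift (x (K := K)) w ∈ Submodule.span K (rightNormedMonomials K w.letters) := by
  have h2 : (2 : K) ≠ 0 := two_ne_zero
  induction w using FreeMagma.rec with
  | of i =>
    refine Submodule.subset_span ⟨0, Fin.elim0, fun _ => i, ?_, rfl⟩
    simp [FreeMagma.letters]
  | mul u v hu hv =>
    rw [FreeMagma.letters]
    match u, v, hu, hv with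
    | .of i, v, _, hv =>
      have e : FreeMagma.lift (x (K := K)) ((FreeMagma.of i).mul v) =
          (2⁻¹ : K) • (Color.white.op (x i) (FreeMagma.lift x v) +
            Color.black.op (x i) (FreeMagma.lift x v)) := by
        have : Color.white.op (x i) (FreeMagma.lift x v) +
            Color.black.op (x i) (FreeMagma.lift x v) =
            (2 : K) • (x i * FreeMagma.lift (x (K := K)) v) := by
          simp only [Color.op, antiComm, Ring.lie_def, two_smul]; abel
        rw [this, inv_smul_smul₀ h2]
        rfl
      rw [e]
      exact Submodule.smul_mem _ _ (add_mem (op_mem_span_rightNormedMonomials _ _ hv)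
        (op_mem_span_rightNormedMonomials _ _ hv))
    | .mul u u', .of i, hu, _ =>
      have e : FreeMagma.lift (x (K := K)) ((u.mul u').mul (FreeMagma.of i)) =
          (2⁻¹ : K) • (Color.white.op (x i) (FreeMagma.lift x (u.mul u')) -
            Color.black.op (x i) (FreeMagma.lift x (u.mul u'))) := by
        have : Color.white.op (x i) (FreeMagma.lift x (u.mul u')) -
            Color.black.op (x i) (FreeMagma.lift x (u.mul u')) =
            (2 : K) • (FreeMagma.lift (x (K := K)) (u.mul u') * x i) := by
          simp only [Color.op, antiComm, Ring.lie_def, two_smul]; abel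
        rw [this, inv_smul_smul₀ h2]
        rfl
      rw [e, add_comm]
      exact Submodule.smul_mem _ _ (sub_mem (op_mem_span_rightNormedMonomials _ _ hu)
        (op_mem_span_rightNormedMonomials _ _ hu))
    | .mul u u', .mul v v', _, _ =>
      have e : FreeMagma.lift (x (K := K)) ((u.mul u').mul (v.mul v')) = 0 := by
        rw [FreeMagma.mul_eq, map_mul]
        exact mul_eq_zero_of_mem_products (mul_mem_products_of_mul _ _)
          (mul_mem_products_of_mul _ _)
      rw [e]
      exact zero_mem _

theorem multilinearPart_eq_wordSpan [Fintype X] [DecidableEq X] :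
    multilinearPart K X = wordSpan K Finset.univ.val := by
  rw [multilinearPart, wordSpan]
  congr 2
  ext w
  change (∀ i, w.letters.count i = 1) ↔ w.letters = Finset.univ.val
  rw [Multiset.ext]
  refine forall_congr' fun i => ?_
  rw [Multiset.count_eq_one_of_mem Finset.univ.nodup (Finset.mem_univ i)]

theorem iSup_patternSpace [CharZero K] (k : ℕ) :
    (⨆ c : Fin k → Color, patternSpace K c) = multilinearPart K (Fin (k + 1)) := by
  apply le_antisymm
  · refine iSup_le fun c => Submodule.span_le.2 ?_
    rintro _ ⟨σ, rfl⟩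
    rw [multilinearPart_eq_wordSpan]
    have h := rightNormed_mem_wordSpan (K := K) c σ
    rwa [Multiset.map_univ_val_equiv] at h
  · rw [multilinearPart_eq_wordSpan, wordSpan, Submodule.span_le]
    rintro _ ⟨w, hw, rfl⟩
    have h := lift_x_mem_span_rightNormedMonomials (K := K) w
    rw [show w.letters = _ from hw] at h
    refine Submodule.span_le.2 ?_ h
    rintro _ ⟨l, c, a, ha, rfl⟩
    -- The letters are the `k + 1` generators, each once: this fixes the length and makes the
    -- arrangement a permutation.
    obtain rfl : l = k := by simpa using congrArg Multiset.card ha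
    have hinj : Function.Injective a := fun i j hij =>
      Multiset.inj_on_of_nodup_map (ha ▸ Finset.univ.nodup) i (Finset.mem_univ i) j
        (Finset.mem_univ j) hij
    exact Submodule.mem_iSup_of_mem c (Submodule.subset_span
      ⟨Equiv.ofBijective a (Finite.injective_iff_bijective.1 hinj), rfl⟩)

end FreeMLA

/-! ### A model that separates the patterns -/

namespace FreeMLA

/-- Families of elements of the free metabelian Lie-admissible algebra indexed by lists of
colours, such that all entries with a nonempty index are sums of products. -/
def patternFamilies (K : Type*) [Field K] (X : Type*) :
    Submodule K (List Color → FreeMLA K X) where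
  carrier := {u | ∀ e l, u (e :: l) ∈ products K X}
  add_mem' hu hv e l := add_mem (hu e l) (hv e l)
  zero_mem' _ _ := zero_mem _
  smul_mem' r _ hu e l := Submodule.smul_mem _ r (hu e l)

namespace patternFamilies

variable {K : Type*} [Field K] {X : Type*}

/-- The entries of the product of two families. -/
def mulFun (u v : List Color → FreeMLA K X) : List Color → FreeMLA K X
  | [] => 0
  | e :: l => e.op (u []) (v l) + e.sign • e.op (v []) (u l)

/-- The first colour of an index stands for the top vertex. Because of the sign, the product is
antisymmetric in its factors at black indices and symmetric at white ones, so brackets live on the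
former and anticommutators on the latter. -/
instance : Mul (patternFamilies K X) :=
  ⟨fun u v => ⟨mulFun u v, fun e _ =>
    add_mem (op_mem_products e _ _) (zsmul_mem (op_mem_products e _ _) _)⟩⟩

theorem mul_nil (u v : patternFamilies K X) : (u * v).1 [] = 0 := rfl

theorem mul_cons (u v : patternFamilies K X) (e : Color) (l : List Color) :
    (u * v).1 (e :: l) = e.op (u.1 []) (v.1 l) + e.sign • e.op (v.1 []) (u.1 l) := rfl

theorem ext' {u v : patternFamilies K X} (h0 : u.1 [] = v.1 [])
    (h : ∀ e l, u.1 (e :: l) = v.1 (e :: l)) : u = v :=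
  Subtype.ext <| funext fun l => match l with
    | [] => h0
    | e :: l => h e l

theorem add_apply (u v : patternFamilies K X) (l : List Color) :
    (u + v).1 l = u.1 l + v.1 l := rfl

theorem sub_apply (u v : patternFamilies K X) (l : List Color) :
    (u - v).1 l = u.1 l - v.1 l := rfl

theorem zero_apply (l : List Color) : (0 : patternFamilies K X).1 l = 0 := rfl

theorem smul_apply (r : K) (u : patternFamilies K X) (l : List Color) :
    (r • u).1 l = r • u.1 l := rfl

instance : NonUnitalNonAssocRing (patternFamilies K X) where
  left_distrib u v w := by
    refine ext' (by simp [mul_nil, add_apply]) fun e l => ?_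
    simp only [mul_cons, add_apply, Color.op_add, Color.add_op, smul_add]
    abel
  right_distrib u v w := by
    refine ext' (by simp [mul_nil, add_apply]) fun e l => ?_
    simp only [mul_cons, add_apply, Color.op_add, Color.add_op, smul_add]
    abel
  zero_mul u := ext' rfl fun e l => by simp [mul_cons, zero_apply]
  mul_zero u := ext' rfl fun e l => by simp [mul_cons, zero_apply]

instance : IsScalarTower K (patternFamilies K X) (patternFamilies K X) where
  smul_assoc r u v := by
    change (r • u) * v = r • (u * v)
    refine ext' (by simp [mul_nil, smul_apply]) fun e l => ?_
    simp only [mul_cons, smul_apply, Color.op_smul, Color.smul_op, smul_add]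
    rw [smul_comm r e.sign]

instance : SMulCommClass K (patternFamilies K X) (patternFamilies K X) where
  smul_comm r u v := by
    change r • (u * v) = u * (r • v)
    refine ext' (by simp [mul_nil, smul_apply]) fun e l => ?_
    simp only [mul_cons, smul_apply, Color.op_smul, Color.smul_op, smul_add]
    rw [smul_comm r e.sign]

theorem lie_nil (u v : patternFamilies K X) : (⁅u, v⁆).1 [] = 0 := by
  rw [Ring.lie_def, sub_apply, mul_nil, mul_nil, sub_zero]

theorem lie_cons_white (u v : patternFamilies K X) (l : List Color) :
    (⁅u, v⁆).1 (.white :: l) = 0 := by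
  rw [Ring.lie_def, sub_apply, mul_cons, mul_cons, Color.sign, one_smul, one_smul]
  abel

theorem lie_cons_black (u v : patternFamilies K X) (l : List Color) :
    (⁅u, v⁆).1 (.black :: l) = (2 : K) • (⁅u.1 [], v.1 l⁆ - ⁅v.1 [], u.1 l⁆) := by
  rw [Ring.lie_def, sub_apply, mul_cons, mul_cons, Color.sign, two_smul]
  simp only [Color.op]
  abel

theorem op_nil (e : Color) (u v : patternFamilies K X) : (e.op u v).1 [] = 0 := by
  cases e
  · exact lie_nil u v
  · change (u * v + v * u).1 [] = 0
    rw [add_apply, mul_nil, mul_nil, add_zero]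

theorem op_cons (e d : Color) (u v : patternFamilies K X) (l : List Color) :
    (e.op u v).1 (d :: l) =
      if d = e then (2 : K) • (e.op (u.1 []) (v.1 l) + e.sign • e.op (v.1 []) (u.1 l)) else 0 := by
  cases e <;> cases d
  · simp [Color.op, lie_cons_black, Color.sign, sub_eq_add_neg]
  · simp [Color.op, lie_cons_white]
  · simp [Color.op, antiComm, add_apply, mul_cons, Color.sign, Ring.lie_def]
    abel
  · simp only [Color.op, antiComm, add_apply, mul_cons, Color.sign, one_smul, if_true, two_smul]
    abel

/-- Products vanish at the empty index, and each entry of a product needs such an entry of one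
factor; this gives the metabelian law. A double bracket lives on indices beginning with two black
vertices. At the shortest one the identity is Jacobi for the entries at the empty index; at longer
ones the terms cancel because brackets commute on sums of products, which is why the families are
restricted. -/
theorem isMetabelianLieAdmissible : IsMetabelianLieAdmissible (patternFamilies K X) where
  metabelian a b c d := ext' rfl fun e l => by
    rw [mul_cons, mul_nil, mul_nil, zero_apply, Color.zero_op, Color.zero_op, smul_zero, add_zero]
  lieAdmissible a b c := by
    rw [lieAdmissibleExpr_eq]
    refine ext' (by simp [add_apply, lie_nil, zero_apply]) fun e l => ?_
    rw [add_apply, add_apply, zero_apply]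
    cases e
    · match l with
      | [] => simp [lie_cons_black, lie_nil]
      | .white :: l => simp [lie_cons_black, lie_nil, lie_cons_white]
      | .black :: [] =>
        simp only [lie_cons_black, lie_nil, zero_lie, lie_smul, lie_sub, zero_sub]
        have h := lie_jacobi (a.1 []) (b.1 []) (c.1 [])
        rw [← lie_skew (a.1 []) (b.1 []), ← lie_skew (b.1 []) (c.1 []),
          ← lie_skew (c.1 []) (a.1 [])]
        rw [← lie_skew (a.1 []) (b.1 []), ← lie_skew (b.1 []) (c.1 []),
          ← lie_skew (c.1 []) (a.1 [])] at h
        simp only [lie_neg] at h ⊢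
        -- Each double bracket gives -8: a 2 from each of two brackets, a 2 from the difference of
        -- `⁅a, b⁆` and `⁅b, a⁆`, and a sign because the outer element stands on the right.
        linear_combination (norm := module) (-8 : K) • h
      | .black :: e :: l =>
        simp only [lie_cons_black, lie_nil, zero_lie, lie_smul, lie_sub, zero_sub]
        rw [lie_lie_comm_of_mem_products (c.1 []) (a.1 []) (b.2 e l),
          lie_lie_comm_of_mem_products (c.1 []) (b.1 []) (a.2 e l),
          lie_lie_comm_of_mem_products (b.1 []) (a.1 []) (c.2 e l)]
        simp only [← smul_neg, ← smul_add]
        abel_nf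
        simp
    · simp [lie_cons_white]

end patternFamilies
end FreeMLA

theorem eq_zero_of_eq_neg (K : Type*) {M : Type*} [Field K] [CharZero K] [AddCommGroup M]
    [Module K M] {m : M} (h : m = -m) : m = 0 := by
  have h2 : (2 : K) • m = 0 := by
    rw [two_smul]
    exact eq_neg_iff_add_eq_zero.1 h
  exact (smul_eq_zero_iff_right two_ne_zero).1 h2

namespace FreeMLA

variable {K : Type*} [Field K] {X : Type*}

/-- The homomorphism that records the pattern of a monomial. -/
def toPatternFamilies (K : Type*) [Field K] (X : Type*) :
    FreeMLA K X →ₙₐ[K] patternFamilies K X :=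
  lift patternFamilies.isMetabelianLieAdmissible fun i =>
    ⟨fun l => if l = [] then x i else 0, fun e l => by simp⟩

theorem toPatternFamilies_x (i : X) (l : List Color) :
    (toPatternFamilies K X (x i)).1 l = if l = [] then x i else 0 := by
  rw [toPatternFamilies, lift_x]

/-- Each vertex prepends its colour and contributes a power of two. The scalar depends only on the
number of vertices, not on colours or leaves. -/
theorem exists_toPatternFamilies_rightNormed [CharZero K] (k : ℕ) :
    ∃ r : K, r ≠ 0 ∧ ∀ (c : Fin k → Color) (a : Fin (k + 1) → X) (l : List Color),
      (toPatternFamilies K X (rightNormed c fun j => x (a j))).1 l =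
        if l = List.ofFn c then r • rightNormed c (fun j => x (a j)) else 0 := by
  have h2 : (2 : K) ≠ 0 := two_ne_zero
  induction k with
  | zero =>
    refine ⟨1, one_ne_zero, fun c a l => ?_⟩
    simp [rightNormed, toPatternFamilies_x]
  | succ k ih =>
    obtain ⟨r, hr, h⟩ := ih
    rcases Nat.eq_zero_or_pos k with rfl | hk
    -- At the innermost vertex both leaves have an entry at the empty index, so two equal terms
    -- double the usual factor 2.
    · refine ⟨2 * 2, mul_ne_zero h2 h2, fun c a l => ?_⟩
      simp only [rightNormed, Color.map_op, Fin.tail]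
      match l with
      | [] => simp [patternFamilies.op_nil]
      | e :: l =>
        rw [patternFamilies.op_cons]
        simp only [toPatternFamilies_x]
        rcases eq_or_ne l [] with rfl | hl
        · simp only [if_true, List.ofFn_succ, List.ofFn_zero, List.cons.injEq, and_true]
          split_ifs with he
          · rw [← Color.op_comm, ← two_smul K, smul_smul]
          · rfl
        · simp [hl]
    -- A tail with a vertex has no entry at the empty index, so only one of the two terms survives.
    · refine ⟨2 * r, mul_ne_zero h2 hr, fun c a l => ?_⟩
      rw [rightNormed_succ, Color.map_op]
      match l with
      | [] => simp [patternFamilies.op_nil]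
      | e :: l =>
        have h' := h (Fin.tail c) (Fin.tail a)
        have h0 : ([] : List Color) ≠ List.ofFn (Fin.tail c) := by
          intro h0
          have := congrArg List.length h0
          simp at this
          omega
        rw [patternFamilies.op_cons]
        change (if _ then (2 : K) • (Color.op _ ((toPatternFamilies K X (x (a 0))).1 [])
          ((toPatternFamilies K X (rightNormed (Fin.tail c) fun j => x (Fin.tail a j))).1 l) +
          _ • Color.op _
            ((toPatternFamilies K X (rightNormed (Fin.tail c) fun j => x (Fin.tail a j))).1 [])
            _) else 0) = _
        rw [h', h', if_neg h0, toPatternFamilies_x, if_pos rfl, Color.zero_op, smul_zero, add_zero,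
          List.ofFn_succ]
        change _ = if e :: l = c 0 :: List.ofFn (Fin.tail c) then _ else _
        simp only [List.cons.injEq]
        by_cases he : e = c 0 <;> by_cases hl : l = List.ofFn (Fin.tail c)
        · rw [if_pos he, if_pos hl, if_pos ⟨he, hl⟩, Color.op_smul, smul_smul]
          rfl
        · simp [he, hl]
        · simp [he]
        · simp [he]

/-- The entry at `c` acts as a nonzero scalar on the space of `c` and kills the spaces of all other
patterns. -/
theorem iSupIndep_patternSpace [CharZero K] (k : ℕ) :
    iSupIndep fun c : Fin k → Color => patternSpace K c := by
  obtain ⟨r, hr, h⟩ := exists_toPatternFamilies_rightNormed (K := K) (X := Fin (k + 1)) k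
  let π (c : Fin k → Color) : FreeMLA K (Fin (k + 1)) →ₗ[K] FreeMLA K (Fin (k + 1)) :=
    (LinearMap.proj (List.ofFn c)).comp ((patternFamilies K (Fin (k + 1))).subtype.comp
      (toPatternFamilies K (Fin (k + 1)) : _ →ₗ[K] patternFamilies K (Fin (k + 1))))
  have hπ : ∀ c p, π c p = (toPatternFamilies K _ p).1 (List.ofFn c) := fun _ _ => rfl
  have h1 : ∀ c, ∀ p ∈ patternSpace K c, π c p = r • p := by
    intro c p hp
    induction hp using Submodule.span_induction with
    | mem y hy =>
      obtain ⟨σ, rfl⟩ := hy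
      rw [hπ, h, if_pos rfl]
    | zero => simp
    | add u v _ _ hu hv => rw [map_add, hu, hv, smul_add]
    | smul s u _ hu => rw [map_smul, hu, smul_comm]
  have h2 : ∀ c d, d ≠ c → patternSpace K d ≤ LinearMap.ker (π c) := by
    intro c d hd
    refine Submodule.span_le.2 ?_
    rintro _ ⟨σ, rfl⟩
    rw [SetLike.mem_coe, LinearMap.mem_ker, hπ, h, if_neg]
    exact fun hcd => hd (List.ofFn_injective hcd).symm
  intro c
  rw [Submodule.disjoint_def]
  intro p hp hp'
  have h3 : p ∈ LinearMap.ker (π c) := (iSup₂_le fun d hd => h2 c d hd) hp'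
  rw [LinearMap.mem_ker, h1 c p hp] at h3
  exact (smul_eq_zero_iff_right hr).1 h3

end FreeMLA

/-! ### A model in which the monomials ending in a white vertex do not vanish -/

/-- The algebra `K × K` with the product `(a, u) (b, v) = (0, a b + a v)`. -/
def LeftModel (K : Type*) : Type _ := K × K

namespace LeftModel

variable {K : Type*}

/-- The element with components `a` and `u`. -/
def mk (a u : K) : LeftModel K := ((a, u) : K × K)

theorem ext' {p q : LeftModel K} (h1 : p.1 = q.1) (h2 : p.2 = q.2) : p = q := Prod.ext h1 h2

@[simp] theorem mk_fst (a u : K) : (mk a u).1 = a := rfl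
@[simp] theorem mk_snd (a u : K) : (mk a u).2 = u := rfl

variable [Field K]

instance : AddCommGroup (LeftModel K) := inferInstanceAs (AddCommGroup (K × K))

instance : Module K (LeftModel K) := inferInstanceAs (Module K (K × K))

instance : Mul (LeftModel K) := ⟨fun p q => ((0, p.1 * q.1 + p.1 * q.2) : K × K)⟩

@[simp] theorem mul_fst (p q : LeftModel K) : (p * q).1 = 0 := rfl
@[simp] theorem mul_snd (p q : LeftModel K) : (p * q).2 = p.1 * q.1 + p.1 * q.2 := rfl
@[simp] theorem add_fst (p q : LeftModel K) : (p + q).1 = p.1 + q.1 := rfl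
@[simp] theorem add_snd (p q : LeftModel K) : (p + q).2 = p.2 + q.2 := rfl
@[simp] theorem sub_fst (p q : LeftModel K) : (p - q).1 = p.1 - q.1 := rfl
@[simp] theorem sub_snd (p q : LeftModel K) : (p - q).2 = p.2 - q.2 := rfl
@[simp] theorem zero_fst : (0 : LeftModel K).1 = 0 := rfl
@[simp] theorem zero_snd : (0 : LeftModel K).2 = 0 := rfl
@[simp] theorem smul_fst (r : K) (p : LeftModel K) : (r • p).1 = r * p.1 := rfl
@[simp] theorem smul_snd (r : K) (p : LeftModel K) : (r • p).2 = r * p.2 := rfl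

instance : NonUnitalNonAssocRing (LeftModel K) where
  left_distrib p q r := ext' (by simp) (by simp; ring)
  right_distrib p q r := ext' (by simp) (by simp; ring)
  zero_mul p := ext' (by simp) (by simp)
  mul_zero p := ext' (by simp) (by simp)

instance : IsScalarTower K (LeftModel K) (LeftModel K) where
  smul_assoc r p q := ext' (by simp [smul_eq_mul]) (by simp [smul_eq_mul]; ring)

instance : SMulCommClass K (LeftModel K) (LeftModel K) where
  smul_comm r p q := ext' (by simp [smul_eq_mul]) (by simp [smul_eq_mul]; ring)

theorem isMetabelianLieAdmissible : IsMetabelianLieAdmissible (LeftModel K) where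
  lieAdmissible a b c := by
    rw [lieAdmissibleExpr_eq]
    refine ext' (by simp [Ring.lie_def]) ?_
    simp only [Ring.lie_def, add_snd, sub_snd, mul_snd, mul_fst, sub_fst, zero_snd]
    ring
  metabelian a b c d := ext' rfl (by simp)

/-- Two copies of `(1, 0)` have anticommutator `(0, 2)`. On elements `(0, u)`, left multiplication
by `(1, 0)` is the identity and right multiplication is zero, so both colours fix this value. -/
theorem rightNormed_const : ∀ {k : ℕ} (c : Fin k → Color), EndsIn c .white →
    (rightNormed c fun _ => mk (1 : K) 0) = mk 0 2
  | 0, _, h => by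
    obtain ⟨i, -⟩ := h
    exact i.elim0
  | 1, c, ⟨i, _, hi⟩ => by
    obtain rfl : i = 0 := Subsingleton.elim _ _
    simp only [rightNormed, hi, Color.op, antiComm, Fin.tail]
    exact ext' (by simp) (by simp; exact one_add_one_eq_two)
  | k + 2, c, ⟨i, hi, hc⟩ => by
    obtain ⟨i, rfl⟩ : ∃ j : Fin (k + 1), i = j.succ :=
      ⟨Fin.last k, Fin.ext (by simp at hi ⊢; omega)⟩
    have h := rightNormed_const (Fin.tail c) ⟨i, by simpa using hi, hc⟩
    rw [rightNormed_succ]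
    change Color.op _ _ (rightNormed (Fin.tail c) fun _ => mk (1 : K) 0) = _
    rw [h]
    cases c 0
    · exact ext' (by simp [Color.op, Ring.lie_def]) (by simp [Color.op, Ring.lie_def])
    · exact ext' (by simp [Color.op, antiComm]) (by simp [Color.op, antiComm])

end LeftModel

namespace FreeMLA

/-- With all generators sent to `(1, 0)`, every summand takes the value `(0, 2)`, so in
characteristic zero nothing cancels. -/
theorem sum_rightNormed_ne_zero {K : Type*} [Field K] [CharZero K] {X : Type*} {k : ℕ}
    {c : Fin k → Color} (hc : EndsIn c .white) {I : Type*} {s : Finset I} (hs : s.Nonempty)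
    (a : I → Fin (k + 1) → X) :
    ∑ i ∈ s, rightNormed c (fun j => x (K := K) (a i j)) ≠ 0 := by
  intro h0
  let φ : FreeMLA K X →ₙₐ[K] LeftModel K :=
    lift LeftModel.isMetabelianLieAdmissible fun _ => LeftModel.mk 1 0
  have h1 : ∀ i, φ (rightNormed c fun j => x (K := K) (a i j)) = LeftModel.mk 0 2 := by
    intro i
    rw [map_rightNormed, ← LeftModel.rightNormed_const c hc]
    congr 1
    funext j
    exact lift_x _ _ _
  have h2 := congrArg φ h0
  rw [map_sum, map_zero, Finset.sum_congr rfl fun i _ => h1 i, Finset.sum_const,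
    ← Nat.cast_smul_eq_nsmul K] at h2
  have h3 : (s.card : K) * 2 = 0 := congrArg Prod.snd h2
  exact mul_ne_zero (Nat.cast_ne_zero.2 hs.card_ne_zero) two_ne_zero h3

end FreeMLA

/-! ### Symmetric elements of the free metabelian Lie algebra -/

namespace FreeMetLie

variable {K : Type*} [Field K] {T : Type*}

theorem eval_lie {M : Type*} [LieRing M] [LieAlgebra K M]
    (hM : ∀ a b c d : M, ⁅⁅a, b⁆, ⁅c, d⁆⁆ = 0) (f : T → M) (a b : FreeMetLie K T) :
    eval (K := K) hM f ⁅a, b⁆ = ⁅eval hM f a, eval hM f b⁆ := by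
  obtain ⟨a, rfl⟩ := LieSubmodule.Quotient.surjective_mk' _ a
  obtain ⟨b, rfl⟩ := LieSubmodule.Quotient.surjective_mk' _ b
  exact LieHom.map_lie (FreeLieAlgebra.lift K f) a b

theorem eval_word (f : T → T) (w : FreeMagma T) :
    eval (lie_metabelian (K := K)) (fun t => y (f t)) (word (K := K) w) = word (FreeMagma.map f w) := by
  induction w using FreeMagma.rec with
  | of t => exact eval_y _ _ _
  | mul u v hu hv =>
    rw [word, eval_lie, hu, hv]
    rfl

theorem _root_.FreeMagma.map_eq_self {f : T → T} (w : FreeMagma T) (h : ∀ t ∈ w.letters, f t = t) :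
    FreeMagma.map f w = w := by
  induction w using FreeMagma.rec with
  | of t => exact congrArg FreeMagma.of (h t (Multiset.mem_singleton_self t))
  | mul u v hu hv =>
    rw [FreeMagma.mul_eq, map_mul, hu fun t ht => h t (Multiset.mem_add.2 (.inl ht)),
      hv fun t ht => h t (Multiset.mem_add.2 (.inr ht))]

/-- A product without repeated letters contains a bracket of two generators, hence it changes
its sign under a suitable transposition. -/
theorem exists_swap_word_eq_neg [DecidableEq T] (w : FreeMagma T) (hw : w.letters.Nodup)
    (hl : ∀ t, w ≠ .of t) : ∃ i ∈ w.letters, ∃ j ∈ w.letters,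
      word (K := K) (FreeMagma.map (Equiv.swap i j) w) = -word w := by
  induction w using FreeMagma.rec with
  | of t => exact absurd rfl (hl t)
  | mul u v hu hv =>
    obtain ⟨nu, nv, hd⟩ := Multiset.nodup_add.1 hw
    have hmap : ∀ i j, word (K := K) (FreeMagma.map (Equiv.swap i j) (u.mul v)) =
        ⁅word (K := K) (FreeMagma.map (Equiv.swap i j) u),
          word (K := K) (FreeMagma.map (Equiv.swap i j) v)⁆ := fun i j => rfl
    -- The factors share no letter, so a transposition found inside one of them does not touch the
    -- other.
    have hfix : ∀ (w₁ w₂ : FreeMagma T), Disjoint w₁.letters w₂.letters →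
        ∀ i ∈ w₁.letters, ∀ j ∈ w₁.letters, FreeMagma.map (Equiv.swap i j) w₂ = w₂ := by
      intro w₁ w₂ hd i hi j hj
      refine FreeMagma.map_eq_self _ fun t ht => Equiv.swap_apply_of_ne_of_ne ?_ ?_
      · rintro rfl
        exact Multiset.disjoint_left.1 hd hi ht
      · rintro rfl
        exact Multiset.disjoint_left.1 hd hj ht
    by_cases hul : ∃ i, u = .of i
    · by_cases hvl : ∃ j, v = .of j
      · obtain ⟨i, rfl⟩ := hul
        obtain ⟨j, rfl⟩ := hvl
        refine ⟨i, by simp [FreeMagma.letters], j, by simp [FreeMagma.letters], ?_⟩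
        rw [hmap]
        change ⁅y (Equiv.swap i j i), y (Equiv.swap i j j)⁆ = -⁅y i, y j⁆
        rw [Equiv.swap_apply_left, Equiv.swap_apply_right, lie_skew]
      · obtain ⟨i, hi, j, hj, h⟩ := hv nv fun t ht => hvl ⟨t, ht⟩
        refine ⟨i, Multiset.mem_add.2 (.inr hi), j, Multiset.mem_add.2 (.inr hj), ?_⟩
        rw [hmap, h, hfix v u hd.symm i hi j hj, lie_neg]
        rfl
    · obtain ⟨i, hi, j, hj, h⟩ := hu nu fun t ht => hul ⟨t, ht⟩
      refine ⟨i, Multiset.mem_add.2 (.inl hi), j, Multiset.mem_add.2 (.inl hj), ?_⟩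
      rw [hmap, h, hfix u v hd i hi j hj, neg_lie]
      rfl

/-- On at least two generators zero is the only symmetric multilinear element of the free
metabelian Lie algebra. -/
theorem multilinearSymmetric_eq_bot [CharZero K] [Fintype T] [DecidableEq T] [Nontrivial T] :
    multilinearSymmetric K T = ⊥ := by
  rw [eq_bot_iff]
  rintro q ⟨hq, hs⟩
  have key : ∀ p ∈ Submodule.span K (word (K := K) '' {w : FreeMagma T | w.IsMultilinear}),
      ∑ τ : Equiv.Perm T, eval (lie_metabelian (K := K)) (fun t => y (τ t)) p = 0 := by
    intro p hp
    induction hp using Submodule.span_induction with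
    | mem p hp =>
      obtain ⟨w, hw, rfl⟩ := hp
      have hw' : ∀ i, w.letters.count i = 1 := hw
      obtain ⟨i, -, j, -, h⟩ := exists_swap_word_eq_neg (K := K) w
        (Multiset.nodup_iff_count_le_one.2 fun i => (hw' i).le) (by
          rintro t rfl
          obtain ⟨s, hs⟩ := exists_ne t
          have := hw' s
          rw [FreeMagma.letters, Multiset.count_singleton, if_neg hs] at this
          exact zero_ne_one this)
      have h1 : ∑ τ : Equiv.Perm T, eval (lie_metabelian (K := K)) (fun t => y (τ t)) (word (K := K) w) =
          -∑ τ : Equiv.Perm T, eval (lie_metabelian (K := K)) (fun t => y (τ t)) (word (K := K) w) := by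
        -- Reindexing by the transposition found in `w` turns the group sum into its negative.
        conv_lhs => rw [← Equiv.sum_comp (Equiv.mulRight (Equiv.swap i j))]
        rw [← Finset.sum_neg_distrib]
        refine Finset.sum_congr rfl fun τ _ => ?_
        rw [← map_neg, ← h, eval_word, eval_word]
        congr 1
        change _ = ((FreeMagma.map τ).comp (FreeMagma.map (Equiv.swap i j))) w
        congr 1
        exact FreeMagma.hom_ext rfl
      exact eq_zero_of_eq_neg K h1
    | zero => simp
    | add u v _ _ hu hv => simp only [map_add, Finset.sum_add_distrib, hu, hv, add_zero]
    | smul r u _ hu => simp only [map_smul, ← Finset.smul_sum, hu, smul_zero]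
  have h1 := key q hq
  rw [Finset.sum_congr rfl fun τ _ => hs τ, Finset.sum_const, Finset.card_univ,
    ← Nat.cast_smul_eq_nsmul K] at h1
  exact (smul_eq_zero_iff_right (Nat.cast_ne_zero.2 Fintype.card_ne_zero)).1 h1

end FreeMetLie

/-! ### Blocks of leaves whose generators may be rearranged -/

section Blocks

variable {k : ℕ} {c : Fin k → Color}

theorem EndsIn.unique {d e : Color} (hd : EndsIn c d) (he : EndsIn c e) : d = e := by
  obtain ⟨i, hi, rfl⟩ := hd
  obtain ⟨j, hj, rfl⟩ := he
  rw [show i = j from Fin.ext (by omega)]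

theorem EndsIn.apply_eq {e : Color} (h : EndsIn c e) {i : Fin k} (hi : (i : ℕ) + 1 = k) :
    c i = e :=
  EndsIn.unique ⟨i, hi, rfl⟩ h

theorem EndsIn.not_inTail (h : EndsIn c .white) {j : Fin (k + 1)} (hj : (j : ℕ) < k) :
    ¬ InTail c j := by
  intro ht
  obtain ⟨i, hi, hc⟩ := h
  have := ht i (by rw [Fin.le_def, Fin.val_castSucc]; omega)
  rw [hc] at this
  cases this

/-- The leaves attached to the positions `i` and `i + 1` may be exchanged: both belong to the
last vertex or to two consecutive black vertices. -/
def Linked (c : Fin k → Color) (i : Fin k) : Prop :=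
  (i : ℕ) + 1 = k ∨ c i = .black ∧ ∃ h : (i : ℕ) + 1 < k, c ⟨i + 1, h⟩ = .black

open Classical in
/-- The number of the block of linked leaves to which a position belongs. -/
def block (c : Fin k → Color) (j : Fin (k + 1)) : ℕ :=
  (Finset.univ.filter fun i : Fin k => i.castSucc < j ∧ ¬ Linked c i).card

theorem block_mono (c : Fin k → Color) : Monotone (block c) := fun _ _ h =>
  Finset.card_le_card fun _ hi => by
    simp only [Finset.mem_filter, Finset.mem_univ, true_and] at hi ⊢
    exact ⟨hi.1.trans_le h, hi.2⟩

theorem block_lt {m : Fin k} (hm : ¬ Linked c m) {i j : Fin (k + 1)} (hi : i ≤ m.castSucc)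
    (hj : m.castSucc < j) : block c i < block c j := by
  classical
  refine Finset.card_lt_card ⟨fun l hl => ?_, fun h => ?_⟩
  · simp only [Finset.mem_filter, Finset.mem_univ, true_and] at hl ⊢
    exact ⟨hl.1.trans (hi.trans_lt hj), hl.2⟩
  · have := h (Finset.mem_filter.2 ⟨Finset.mem_univ m, hj, hm⟩)
    simp only [Finset.mem_filter, Finset.mem_univ, true_and] at this
    exact this.1.not_ge hi

theorem block_succ {i : Fin k} (hi : Linked c i) : block c i.succ = block c i.castSucc := by
  classical
  refine congrArg Finset.card (Finset.filter_congr fun l _ => ?_)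
  refine and_congr_left fun hl => ?_
  have : l ≠ i := by rintro rfl; exact hl hi
  rw [Fin.lt_def, Fin.lt_def, Fin.val_succ, Fin.val_castSucc, Fin.val_castSucc]
  have := Fin.val_ne_of_ne this
  omega

theorem linked_of_block_eq {i : Fin k} (h : block c i.castSucc = block c i.succ) :
    Linked c i := by
  by_contra hi
  exact (block_lt hi le_rfl i.castSucc_lt_succ).ne h

theorem block_castSucc_eq_last {i : Fin k} (hi : (i : ℕ) + 1 = k) :
    block c i.castSucc = block c (Fin.last k) := by
  rw [← block_succ (.inl hi)]
  congr 1
  exact Fin.ext (by simpa using hi)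

/-- If the last vertex is white, then its block consists of its two leaves. -/
theorem EndsIn.block_lt_last (h : EndsIn c .white) {i : Fin k} (hi : (i : ℕ) + 1 < k) :
    block c i.castSucc < block c (Fin.last k) := by
  -- The gap just before the last vertex separates blocks: linking there would need a black last
  -- vertex.
  have hm : ¬ Linked c ⟨k - 2, by omega⟩ := by
    rintro (h1 | ⟨-, h1, h2⟩)
    · simp at h1; omega
    · rw [h.apply_eq (by simp; omega)] at h2
      cases h2
  refine block_lt hm ?_ ?_
  · rw [Fin.le_def]; simp; omega
  · rw [Fin.lt_def]; simp; omega

/-- The permutations of the positions that preserve all blocks. -/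
def blockPerms (c : Fin k → Color) : Subgroup (Equiv.Perm (Fin (k + 1))) where
  carrier := {h | ∀ j, block c (h j) = block c j}
  mul_mem' {g h} hg hh j := (hg (h j)).trans (hh j)
  one_mem' _ := rfl
  inv_mem' {h} hh j := by
    have := hh (h⁻¹ j)
    rw [show h (h⁻¹ j) = j from h.apply_symm_apply j] at this
    exact this.symm

/-- The transpositions of neighbouring leaves in a common block. -/
def linkedSwaps (c : Fin k → Color) : Set (Equiv.Perm (Fin (k + 1))) :=
  {τ | ∃ i, Linked c i ∧ τ = Equiv.swap i.castSucc i.succ}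

/-- Block numbers are monotone, so all positions between `i` and `j` share the block, and swaps of
neighbours carry `i` to `j` step by step. -/
theorem mem_orbit_linkedSwaps (i j : Fin (k + 1)) (hij : i ≤ j) (h : block c i = block c j) :
    j ∈ MulAction.orbit (Subgroup.closure (linkedSwaps c)) i := by
  induction j using Fin.induction with
  | zero =>
    obtain rfl : i = 0 := Fin.le_zero_iff.1 hij
    exact MulAction.mem_orbit_self _
  | succ j ih =>
    rcases hij.eq_or_lt with rfl | hlt
    · exact MulAction.mem_orbit_self _
    · have h1 : i ≤ j.castSucc := Fin.le_castSucc_iff.2 hlt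
      have h2 : block c i = block c j.castSucc :=
        le_antisymm (block_mono c h1) (h ▸ block_mono c j.castSucc_lt_succ.le)
      obtain ⟨g, hg⟩ := ih h1 h2
      have hj : Linked c j := linked_of_block_eq (h2.symm.trans h)
      let s : Subgroup.closure (linkedSwaps c) :=
        ⟨_, Subgroup.subset_closure ⟨j, hj, rfl⟩⟩
      refine ⟨s * g, ?_⟩
      change (s * g) • i = _
      rw [mul_smul, show g • i = j.castSucc from hg]
      exact Equiv.swap_apply_left _ _

/-- Transpositions generate every finitely supported permutation that preserves their orbits, so
transitivity on blocks suffices. -/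
theorem blockPerms_le_closure (c : Fin k → Color) :
    blockPerms c ≤ Subgroup.closure (linkedSwaps c) := by
  intro h hh
  rw [mem_closure_isSwap]
  · refine ⟨Set.toFinite _, fun j => ?_⟩
    rcases le_total j (h j) with hj | hj
    · exact mem_orbit_linkedSwaps _ _ hj (hh j).symm
    · rw [MulAction.mem_orbit_symm]
      exact (mem_orbit_linkedSwaps _ _ hj (hh j))
  · rintro _ ⟨i, -, rfl⟩
    exact ⟨_, _, i.castSucc_lt_succ.ne, rfl⟩

/-- The key by which the positions are sorted in an admissible arrangement. -/
def sortKey (c : Fin k → Color) (σ : Equiv.Perm (Fin (k + 1))) (j : Fin (k + 1)) : ℕ ×ₗ ℤ :=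
  toLex (block c j, if block c j = block c (Fin.last k) then (σ j : ℤ) else -(σ j : ℤ))

theorem sortKey_le_iff {σ : Equiv.Perm (Fin (k + 1))} {i j : Fin (k + 1)} :
    sortKey c σ i ≤ sortKey c σ j ↔ block c i < block c j ∨ block c i = block c j ∧
      if block c j = block c (Fin.last k) then σ i ≤ σ j else σ j ≤ σ i := by
  rw [sortKey, sortKey, Prod.Lex.toLex_le_toLex]
  refine or_congr_right (and_congr_right fun h => ?_)
  simp only at h
  simp only [h]
  split_ifs <;> rw [Fin.le_def] <;> omega

theorem sortKey_injective (c : Fin k → Color) (σ : Equiv.Perm (Fin (k + 1))) :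
    Function.Injective (sortKey c σ) := by
  intro i j h
  have h1 := sortKey_le_iff.1 h.le
  have h2 := sortKey_le_iff.1 h.ge
  have hb : block c i = block c j := congrArg (fun p => (ofLex p).1) h
  rw [hb] at h1 h2
  simp only [lt_irrefl, true_and, false_or] at h1 h2
  apply σ.injective
  split_ifs at h1 h2
  exacts [le_antisymm h1 h2, le_antisymm h2 h1]

theorem sortKey_mul (σ : Equiv.Perm (Fin (k + 1))) {h : Equiv.Perm (Fin (k + 1))}
    (hh : h ∈ blockPerms c) : sortKey c (σ * h) = sortKey c σ ∘ h := by
  funext j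
  rw [Function.comp_apply, sortKey, sortKey, hh j]
  rfl

/-- Within a block the key ascends with the generator at the last vertex and descends with it
elsewhere, which matches the two ordering conditions. The condition on the tail is empty, as only
the last leaf lies in it. -/
theorem admissible_iff_monotone (hc : EndsIn c .white) (σ : Equiv.Perm (Fin (k + 1))) :
    Admissible c σ ↔ Monotone (sortKey c σ) := by
  constructor
  · intro h
    rw [Fin.monotone_iff_le_succ]
    intro i
    rw [sortKey_le_iff]
    by_cases hi : Linked c i
    · refine .inr ⟨(block_succ hi).symm, ?_⟩
      rw [block_succ hi]
      rcases hi with hi | ⟨hb, hlt, hb'⟩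
      · rw [if_pos (block_castSucc_eq_last hi)]
        exact (h.white_end i hi (hc.apply_eq hi)).le
      · rw [if_neg (hc.block_lt_last hlt).ne]
        exact (h.black_run i ⟨i + 1, hlt⟩ rfl hb hb' (hc.not_inTail i.2)).le
    · exact .inl (block_lt hi le_rfl i.castSucc_lt_succ)
  · intro h
    refine ⟨fun i j hij hi hj _ => ?_, fun i hi _ => ?_, fun i j hi _ hij => ?_⟩
    · have hl : Linked c i := by
        refine .inr ⟨hi, by omega, ?_⟩
        rwa [show (⟨i + 1, _⟩ : Fin k) = j from Fin.ext hij]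
      have hs : i.succ = j.castSucc := Fin.ext (by simpa using hij)
      have h1 := sortKey_le_iff.1 (h i.castSucc_lt_succ.le)
      rw [block_succ hl, if_neg (hc.block_lt_last (by omega)).ne, hs] at h1
      refine lt_of_le_of_ne (h1.resolve_left (lt_irrefl _)).2 fun h2 => ?_
      have := σ.injective h2
      rw [← hs] at this
      exact i.castSucc_lt_succ.ne' this
    · have h1 := sortKey_le_iff.1 (h i.castSucc_lt_succ.le)
      rw [block_succ (.inl hi), if_pos (block_castSucc_eq_last hi)] at h1
      exact lt_of_le_of_ne (h1.resolve_left (lt_irrefl _)).2 fun h2 =>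
        i.castSucc_lt_succ.ne (σ.injective h2)
    · exact absurd hi (hc.not_inTail (by have := j.2; have := Fin.lt_def.1 hij; omega))

theorem exists_admissible_mul (hc : EndsIn c .white) (σ : Equiv.Perm (Fin (k + 1))) :
    ∃ h ∈ blockPerms c, Admissible c (σ * h) := by
  have hm := Tuple.monotone_sort (sortKey c σ)
  have hb : Monotone (block c ∘ Tuple.sort (sortKey c σ)) := fun i j hij => by
    rcases sortKey_le_iff.1 (hm hij) with h | h
    exacts [h.le, h.1.le]
  -- Before and after sorting the block numbers are monotone rearrangements of the same sequence,
  -- hence equal.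
  have hh : Tuple.sort (sortKey c σ) ∈ blockPerms c :=
    congrFun (Tuple.unique_monotone (τ := 1) hb (block_mono c))
  refine ⟨_, hh, ?_⟩
  rwa [admissible_iff_monotone hc, sortKey_mul σ hh]

/-- An injective key has only one increasing arrangement, so a coset of `blockPerms` contains at
most one admissible element. -/
theorem Admissible.eq_one_of_mul (hc : EndsIn c .white) {σ h : Equiv.Perm (Fin (k + 1))}
    (hσ : Admissible c σ) (hh : h ∈ blockPerms c) (hσh : Admissible c (σ * h)) : h = 1 := by
  rw [admissible_iff_monotone hc] at hσ hσh
  rw [sortKey_mul σ hh] at hσh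
  have := Tuple.unique_monotone (τ := 1) hσh hσ
  exact Equiv.ext fun j => sortKey_injective c σ (congrFun this j)

end Blocks

/-! ### Orbit sums and the polynomials of the patterns -/

namespace FreeMLA

variable {K : Type*} [Field K] {k : ℕ} {c : Fin k → Color}

theorem rightNormed_comp_blockPerms {X : Type*} (hc : EndsIn c .white)
    {h : Equiv.Perm (Fin (k + 1))} (hh : h ∈ blockPerms c) (a : Fin (k + 1) → FreeMLA K X) :
    rightNormed c (a ∘ h) = rightNormed c a := by
  have hcl := blockPerms_le_closure c hh
  clear hh
  induction hcl using Subgroup.closure_induction generalizing a with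
  | mem τ hτ =>
    obtain ⟨i, hi, rfl⟩ := hτ
    rcases hi with hi | ⟨hb, hlt, hb'⟩
    · rw [rightNormed_swap_last c a i hi, hc.apply_eq hi, Color.sign, one_smul]
    · refine rightNormed_swap_black c a i ?_ hb hb'
      -- Otherwise the second of the two black vertices would be the last one, which is white.
      by_contra h2
      rw [hc.apply_eq (by simp; omega)] at hb'
      cases hb'
  | one => rfl
  | mul g h _ _ hg hh => exact (hh (a ∘ g)).trans (hg a)
  | inv g _ hg =>
    have := hg (a ∘ ⇑g⁻¹)
    rw [← this, Function.comp_assoc, ← Equiv.Perm.coe_mul, inv_mul_cancel]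
    rfl

/-- Every arrangement is uniquely an admissible one times a block permutation, and the monomial is
constant on these cosets. -/
theorem sum_rightNormed_eq_smul_whiteEndPoly (hc : EndsIn c .white) :
    ∑ σ : Equiv.Perm (Fin (k + 1)), rightNormed c (fun j => x (K := K) (σ j)) =
      (Nat.card (blockPerms c) : K) • whiteEndPoly K c := by
  classical
  rw [whiteEndPoly, Nat.cast_smul_eq_nsmul, Nat.card_eq_fintype_card, ← Finset.card_univ,
    ← Finset.sum_const, ← Finset.sum_product']
  symm
  refine Finset.sum_nbij (fun p : blockPerms c × Equiv.Perm (Fin (k + 1)) => p.2 * p.1)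
    (fun _ _ => Finset.mem_univ _) ?_ ?_ ?_
  · rintro ⟨⟨g, hg⟩, σ⟩ hp ⟨⟨h, hh⟩, τ⟩ hq (hpq : σ * g = τ * h)
    simp only [Finset.coe_product, Finset.coe_filter, Set.mem_prod] at hp hq
    have hσ : Admissible c σ := by simpa using hp
    have hτ : Admissible c τ := by simpa using hq
    have e : τ = σ * (g * h⁻¹) := by rw [← mul_assoc, hpq, mul_inv_cancel_right]
    have h1 : g * h⁻¹ = 1 :=
      hσ.eq_one_of_mul hc (mul_mem hg (inv_mem hh)) (e ▸ hτ)
    obtain rfl : g = h := mul_inv_eq_one.1 h1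
    rw [h1, mul_one] at e
    rw [e]
  · intro σ _
    obtain ⟨h, hh, ha⟩ := exists_admissible_mul hc σ
    exact ⟨(⟨h⁻¹, inv_mem hh⟩, σ * h), by simpa using ha, by simp⟩
  · rintro ⟨⟨h, hh⟩, σ⟩ _
    exact (rightNormed_comp_blockPerms hc hh fun j => x (σ j)).symm

theorem whiteEndPoly_ne_zero [CharZero K] (hc : EndsIn c .white) : whiteEndPoly K c ≠ 0 := by
  classical
  obtain ⟨h, -, hh⟩ := exists_admissible_mul hc 1
  exact sum_rightNormed_ne_zero hc ⟨1 * h, by simpa using hh⟩ fun σ => σ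

theorem patternPolys_of_endsIn_white (hc : EndsIn c .white) :
    patternPolys K c = {whiteEndPoly K c} := by
  ext p
  constructor
  · rintro (⟨-, h⟩ | ⟨h, -⟩)
    · exact h
    · exact absurd (h.unique hc) (by decide)
  · exact fun h => .inl ⟨hc, h⟩

theorem rightNormedTail_zero {A : Type*} [NonUnitalNonAssocRing A] :
    ∀ {k : ℕ} (c : Fin k → Color) (a : Fin (k + 1) → A), rightNormedTail c a 0 = 0
  | 0, _, _ => rfl
  | _ + 1, c, a => by
    rw [rightNormedTail, rightNormedTail_zero]
    simp

theorem patternPolys_of_endsIn_black [CharZero K] (hc : EndsIn c .black) :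
    patternPolys K c = {0} := by
  have h0 : blackEndPoly (K := K) c 0 = 0 := by
    simp [blackEndPoly, rightNormedTail_zero]
  -- Both leaves of the last vertex lie in the tail, so the Lie polynomial has at least two
  -- generators and must vanish.
  have : Nontrivial {j : Fin (k + 1) // InTail c j} := by
    obtain ⟨i, hi, hci⟩ := hc
    refine ⟨⟨i.castSucc, fun j hj => ?_⟩, ⟨i.succ, fun j hj => ?_⟩, fun h => ?_⟩
    · rwa [show j = i from Fin.ext (by have := Fin.le_def.1 hj; simp at this; omega)]
    · have := Fin.le_def.1 hj; simp at this; omega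
    · exact i.castSucc_lt_succ.ne (congrArg Subtype.val h)
  classical
  ext p
  constructor
  · rintro (⟨h, -⟩ | ⟨-, q, hq, rfl⟩)
    · exact absurd (h.unique hc) (by decide)
    · rw [FreeMetLie.multilinearSymmetric_eq_bot, Submodule.mem_bot] at hq
      rw [hq, h0]
      rfl
  · rintro rfl
    exact .inr ⟨hc, 0, zero_mem _, h0.symm⟩

theorem sum_rightNormed_eq_zero [CharZero K] (hc : EndsIn c .black) :
    ∑ σ : Equiv.Perm (Fin (k + 1)), rightNormed c (fun j => x (K := K) (σ j)) = 0 := by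
  obtain ⟨i, hi, hci⟩ := hc
  have h : ∑ σ : Equiv.Perm (Fin (k + 1)), rightNormed c (fun j => x (K := K) (σ j)) =
      -∑ σ : Equiv.Perm (Fin (k + 1)), rightNormed c (fun j => x (K := K) (σ j)) := by
    conv_lhs => rw [← Equiv.sum_comp (Equiv.mulRight (Equiv.swap i.castSucc i.succ))]
    rw [← Finset.sum_neg_distrib]
    refine Finset.sum_congr rfl fun σ _ => ?_
    have := rightNormed_swap_last c (fun j => x (K := K) (σ j)) i hi
    rwa [hci, Color.sign, neg_one_zsmul] at this
  exact eq_zero_of_eq_neg K h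

theorem endsIn_white_or_black (hk : k ≠ 0) (c : Fin k → Color) :
    EndsIn c .white ∨ EndsIn c .black := by
  let i : Fin k := ⟨k - 1, by omega⟩
  have hi : (i : ℕ) + 1 = k := by simp [i]; omega
  cases h : c i
  exacts [.inr ⟨i, hi, h⟩, .inl ⟨i, hi, h⟩]

/-- The pattern must be nonempty: without a last vertex there are no pattern polynomials, while the
orbit sum is a generator. -/
theorem span_sum_rightNormed [CharZero K] (hk : k ≠ 0) (c : Fin k → Color) :
    Submodule.span K {∑ σ : Equiv.Perm (Fin (k + 1)), rightNormed c fun j => x (K := K) (σ j)} =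
      Submodule.span K (patternPolys K c) := by
  rcases endsIn_white_or_black hk c with hc | hc
  · rw [sum_rightNormed_eq_smul_whiteEndPoly hc, patternPolys_of_endsIn_white hc]
    exact Submodule.span_singleton_smul_eq
      (Nat.cast_ne_zero.2 Nat.card_pos.ne').isUnit _
  · rw [sum_rightNormed_eq_zero hc, patternPolys_of_endsIn_black hc]

/-- The group sum of a monomial is the orbit sum of its pattern, so averaging the spanning monomials
suffices. -/
theorem symmetric_inf_multilinearPart [CharZero K] (hk : k ≠ 0) :
    symmetric K (Fin (k + 1)) ⊓ multilinearPart K (Fin (k + 1)) =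
      Submodule.span K (⋃ c : Fin k → Color, patternPolys K c) := by
  rw [Submodule.span_iUnion]
  apply le_antisymm
  · rw [← iSup_patternSpace]
    simp only [patternSpace]
    rw [← Submodule.span_iUnion]
    refine symmetric_inf_span_le fun y hy => ?_
    obtain ⟨c, τ, rfl⟩ := Set.mem_iUnion.1 hy
    refine Submodule.mem_iSup_of_mem c ?_
    rw [← span_sum_rightNormed hk]
    dsimp only
    rw [sum_permute_rightNormed]
    exact Submodule.mem_span_singleton_self _
  · refine iSup_le fun c => ?_
    rw [← span_sum_rightNormed hk, ← symmetric_inf_patternSpace, ← iSup_patternSpace]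
    exact inf_le_inf_left _ (le_iSup (fun c => patternSpace K c) c)

/-! ### Degrees one and two -/

theorem symmetric_inf_span_x [CharZero K] (n : ℕ) :
    symmetric K (Fin n) ⊓ Submodule.span K (Set.range fun i : Fin n => x (K := K) i) =
      Submodule.span K {pOne K n} :=
  symmetric_inf_span_orbit (fun i : Fin n => x (K := K) i) (fun σ => σ) (fun _ _ => rfl)
    permute_x fun i j => ⟨Equiv.swap i j, Equiv.swap_apply_left i j⟩

theorem symmetric_inf_span_x_mul_x [CharZero K] (n : ℕ) :
    symmetric K (Fin n) ⊓
        Submodule.span K {f | ∃ i j : Fin n, i ≠ j ∧ f = x (K := K) i * x j} =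
      Submodule.span K {pTwo K n} := by
  let I := {ij : Fin n × Fin n // ij.1 ≠ ij.2}
  let m : I → FreeMLA K (Fin n) := fun ij => x ij.1.1 * x ij.1.2
  let f : Equiv.Perm (Fin n) → Equiv.Perm I := fun σ =>
    (Equiv.prodCongr σ σ).subtypeEquiv fun ij => (σ.injective.ne_iff).symm
  have h := symmetric_inf_span_orbit m f (fun _ _ => rfl)
    (fun σ ij => by simp only [m, map_mul, permute_x]; rfl) (by
      rintro ⟨⟨i, j⟩, hij⟩ ⟨⟨i', j'⟩, hij'⟩
      obtain ⟨σ, h1, h2⟩ := MulAction.is_two_pretransitive_iff.1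
        (Equiv.Perm.isMultiplyPretransitive (Fin n) 2) hij hij'
      exact ⟨σ, Subtype.ext (Prod.ext h1 h2)⟩)
  have h1 : Set.range m = {f | ∃ i j : Fin n, i ≠ j ∧ f = x (K := K) i * x j} := by
    ext p
    constructor
    · rintro ⟨⟨⟨i, j⟩, hij⟩, rfl⟩
      exact ⟨i, j, hij, rfl⟩
    · rintro ⟨i, j, hij, rfl⟩
      exact ⟨⟨⟨i, j⟩, hij⟩, rfl⟩
  -- The sum runs over ordered pairs, so each product `x i * x j` occurs twice: from `(i, j)` and
  -- from `(j, i)`.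
  have h2 : pTwo K n = (2 : K) • ∑ ij, m ij := by
    have e1 : ∑ ij, m ij = ∑ ij : Fin n × Fin n with ij.1 ≠ ij.2, x (K := K) ij.1 * x ij.2 :=
      (Finset.sum_subtype _ (by simp) fun ij : Fin n × Fin n => x (K := K) ij.1 * x ij.2).symm
    have e2 : ∑ ij, m ij = ∑ ij : Fin n × Fin n with ij.1 ≠ ij.2, x (K := K) ij.2 * x ij.1 := by
      rw [e1]
      exact Finset.sum_equiv (Equiv.prodComm _ _) (by simp [ne_comm]) (by simp)
    rw [two_smul]
    nth_rewrite 1 [e1]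
    rw [e2, ← Finset.sum_add_distrib]
    rfl
  rw [← h1, h, h2]
  exact (Submodule.span_singleton_smul_eq (isUnit_iff_ne_zero.2 two_ne_zero) _).symm

theorem multilinearPart_one [CharZero K] :
    multilinearPart K (Fin 1) = Submodule.span K (Set.range fun i : Fin 1 => x (K := K) i) := by
  rw [← iSup_patternSpace]
  apply le_antisymm
  · refine iSup_le fun c => Submodule.span_mono ?_
    rintro _ ⟨σ, rfl⟩
    exact ⟨σ 0, rfl⟩
  · refine le_iSup_of_le (Fin.elim0 : Fin 0 → Color) (Submodule.span_mono ?_)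
    rintro _ ⟨i, rfl⟩
    refine ⟨1, ?_⟩
    rw [Subsingleton.elim i 0]
    rfl

theorem multilinearPart_two [CharZero K] :
    multilinearPart K (Fin 2) =
      Submodule.span K {f | ∃ i j : Fin 2, i ≠ j ∧ f = x (K := K) i * x j} := by
  apply le_antisymm
  · rw [← iSup_patternSpace]
    refine iSup_le fun c => Submodule.span_le.2 ?_
    rintro _ ⟨σ, rfl⟩
    have h1 : x (K := K) (σ 0) * x (σ 1) ∈
        Submodule.span K {f | ∃ i j : Fin 2, i ≠ j ∧ f = x (K := K) i * x j} :=
      Submodule.subset_span ⟨_, _, σ.injective.ne zero_ne_one, rfl⟩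
    have h2 : x (K := K) (σ 1) * x (σ 0) ∈
        Submodule.span K {f | ∃ i j : Fin 2, i ≠ j ∧ f = x (K := K) i * x j} :=
      Submodule.subset_span ⟨_, _, σ.injective.ne one_ne_zero, rfl⟩
    change (c 0).op (x (σ 0)) (x (σ 1)) ∈ _
    cases c 0
    exacts [sub_mem h1 h2, add_mem h1 h2]
  · rw [Submodule.span_le]
    rintro _ ⟨i, j, hij, rfl⟩
    rw [multilinearPart_eq_wordSpan, show (Finset.univ : Finset (Fin 2)).val = {i} + {j} by
      revert i j; decide]
    exact mul_mem_wordSpan (x_mem_wordSpan i) (x_mem_wordSpan j)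

end FreeMLA

end

/-! ### Assembly of the theorem -/

theorem mainTheorem4 (K : Type*) [Field K] [CharZero K] :
    -- degree `n = k + 1 ≥ 3`: colour patterns of length `k = n - 1`
    (∀ k : ℕ, 2 ≤ k →
      -- the multilinear part is the direct sum of the pattern spaces
      (iSupIndep fun c : Fin k → Color => FreeMLA.patternSpace K c) ∧
      (⨆ c : Fin k → Color, FreeMLA.patternSpace K c) =
        FreeMLA.multilinearPart K (Fin (k + 1)) ∧
      -- each pattern space is stable under the symmetric group
      (∀ (c : Fin k → Color) (σ : Equiv.Perm (Fin (k + 1))),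
        ∀ f ∈ FreeMLA.patternSpace K c, FreeMLA.permute σ f ∈ FreeMLA.patternSpace K c) ∧
      -- the symmetric polynomials in a pattern space are the multiples of its polynomial
      (∀ c : Fin k → Color,
        FreeMLA.symmetric K (Fin (k + 1)) ⊓ FreeMLA.patternSpace K c =
          Submodule.span K (FreeMLA.patternPolys K c)) ∧
      -- it is nonzero exactly for the patterns whose last vertex is white
      (∀ c : Fin k → Color, EndsIn c .white →
        FreeMLA.patternPolys K c = {FreeMLA.whiteEndPoly K c} ∧
          FreeMLA.whiteEndPoly K c ≠ 0) ∧
      (∀ c : Fin k → Color, EndsIn c .black → FreeMLA.patternPolys K c = {0}) ∧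
      -- all symmetric polynomials of the multilinear part
      FreeMLA.symmetric K (Fin (k + 1)) ⊓ FreeMLA.multilinearPart K (Fin (k + 1)) =
        Submodule.span K (⋃ c : Fin k → Color, FreeMLA.patternPolys K c)) ∧
    -- the multilinear parts in degrees 1 and 2
    FreeMLA.symmetric K (Fin 1) ⊓ FreeMLA.multilinearPart K (Fin 1) =
      Submodule.span K {FreeMLA.pOne K 1} ∧
    FreeMLA.symmetric K (Fin 2) ⊓ FreeMLA.multilinearPart K (Fin 2) =
      Submodule.span K {FreeMLA.pTwo K 2} ∧
    -- degrees 1 and 2 (different generators) with any number of generators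
    (∀ n : ℕ, FreeMLA.symmetric K (Fin n) ⊓
        Submodule.span K (Set.range fun i : Fin n => FreeMLA.x (K := K) i) =
      Submodule.span K {FreeMLA.pOne K n}) ∧
    (∀ n : ℕ, FreeMLA.symmetric K (Fin n) ⊓
        Submodule.span K {f | ∃ i j : Fin n, i ≠ j ∧ f = FreeMLA.x (K := K) i * FreeMLA.x j} =
      Submodule.span K {FreeMLA.pTwo K n}) := by
  refine ⟨fun k hk => ?_, ?_, ?_, FreeMLA.symmetric_inf_span_x, FreeMLA.symmetric_inf_span_x_mul_x⟩
  · have hk0 : k ≠ 0 := by omega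
    refine ⟨FreeMLA.iSupIndep_patternSpace k, FreeMLA.iSup_patternSpace k,
      FreeMLA.permute_mem_patternSpace, fun c => ?_,
      fun c hc => ⟨FreeMLA.patternPolys_of_endsIn_white hc, FreeMLA.whiteEndPoly_ne_zero hc⟩,
      fun c hc => FreeMLA.patternPolys_of_endsIn_black hc, FreeMLA.symmetric_inf_multilinearPart hk0⟩
    rw [FreeMLA.symmetric_inf_patternSpace, FreeMLA.span_sum_rightNormed hk0]
  · rw [FreeMLA.multilinearPart_one, FreeMLA.symmetric_inf_span_x]
  · rw [FreeMLA.multilinearPart_two, FreeMLA.symmetric_inf_span_x_mul_x]
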